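/- Let $\mathbb R^4_1$ be $\mathbb R^4$ with the metric $\langle\cdot,\cdot\rangle=dx_1^2+dx_2^2+dx_3^2-dx_4^2$. For a smooth parametrized surface $z=z(u,v)$ in $\mathbb R^4_1$ put $E=\langle z_u,z_u\rangle$, $F=\langle z_u,z_v\rangle$, $G=\langle z_v,z_v\rangle$. The surface is timelike if its induced metric has signature $(1,1)$, i.e. $EG-F^2<0$. Let $\sigma$ be its second fundamental tensor and $H=\frac12\operatorname{tr}\sigma$ its mean curvature vector. A point is flat if the values of $\sigma$ there span a space of dimension at most $1$. A geometric frame field of a timelike surface with $H=0$ and no flat points, with geometric functions $\nu,\mu$, is a smooth field of orthonormal frames $\{x,y,n_1,n_2\}$ along the surface, with $x,y$ tangent, $x$ timelike, $n_1,n_2$ normal, such that $$\sigma(x,x)=\nu n_1,\qquad \sigma(x,y)=\mu n_2,\qquad \sigma(y,y)=\nu n_1 .$$ The parameters $(u,v)$ are canonical if $z_u=\sqrt{-E}\,x$, $z_v=\sqrt{G}\,y$ and $E=-\dfrac1{\sqrt{\mu^2+\nu^2}}$, $F=0$, $G=\dfrac1{\sqrt{\mu^2+\nu^2}}$. **Theorem.**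 Let $\mu(u,v)$ and $\nu(u,v)$ be smooth functions on a domain (nonempty connected open set) $\mathcal D\subset\mathbb R^2$ such that everywhere on $\mathcal D$ $$\mu\nu\neq0,\qquad \mu^2-\nu^2\neq0,$$ $$(\mu^2+\nu^2)^{1/2}\,\Delta^h\ln(\mu^2+\nu^2)^{1/4}=\nu^2-\mu^2,\qquad (\mu^2+\nu^2)^{1/2}\,\Delta^h\arctan\frac{\mu}{\nu}=2\nu\mu,$$ where $\Delta^h=\partial_u^2-\partial_v^2$. Let $(u_0,v_0)\in\mathcal D$, let $p_0\in\mathbb R^4_1$, and let $\{x_0,y_0,(n_1)_0,(n_2)_0\}$ be an orthonormal frame at $p_0$ with $x_0$ timelike and $y_0,(n_1)_0,(n_2)_0$ spacelike. Then there are a subdomain $\mathcal D_0\subset\mathcal D$ containing $(u_0,v_0)$ and a unique timelike surface $z=z(u,v)$, $(u,v)\in\mathcal D_0$, with zero mean curvature and without flat points, such that $z(u_0,v_0)=p_0$, the surface has a geometric frame field with geometric functions $\nu(u,v),\mu(u,v)$ which equals $\{x_0,y_0,(n_1)_0,(n_2)_0\}$ at $(u_0,v_0)$, and $(u,v)$ are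 canonical parameters with respect to this frame field. The uniqueness is local: if $\mathcal D_1\subset\mathcal D_0$ is a subdomain containing $(u_0,v_0)$ and $z_1=z_1(u,v)$, $(u,v)\in\mathcal D_1$, is a surface with all the same properties on $\mathcal D_1$, then $z_1=z$ on $\mathcal D_1$. -/

import Mathlib

open scoped ContDiff

noncomputable section

namespace TimelikeSurface

/-- The vector space underlying the Minkowski space with its standard coordinates. -/
abbrev R41 : Type := Fin 4 → ℝ

/-- The Minkowski metric `dx₁² + dx₂² + dx₃² - dx₄²`. -/
def mink (a b : R41) : ℝ := a 0 * b 0 + a 1 * b 1 + a 2 * b 2 - a 3 * b 3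

/-- A frame `x, y, n₁, n₂` of Minkowski space that is orthonormal, with `x` timelike
and `y, n₁, n₂` spacelike. -/
structure IsOrthonormalFrame (x y n₁ n₂ : R41) : Prop where
  xx : mink x x = -1
  yy : mink y y = 1
  n₁n₁ : mink n₁ n₁ = 1
  n₂n₂ : mink n₂ n₂ = 1
  xy : mink x y = 0
  xn₁ : mink x n₁ = 0
  xn₂ : mink x n₂ = 0
  yn₁ : mink y n₁ = 0
  yn₂ : mink y n₂ = 0
  n₁n₂ : mink n₁ n₂ = 0

/-- A domain in the parameter plane: a nonempty connected open set. -/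
def IsDomain2 (D : Set (ℝ × ℝ)) : Prop := IsOpen D ∧ IsConnected D

section Calculus

variable {V : Type*} [NormedAddCommGroup V] [NormedSpace ℝ V]

/-- The partial derivative with respect to the first parameter `u`. -/
def du (f : ℝ × ℝ → V) (p : ℝ × ℝ) : V := fderiv ℝ f p (1, 0)

/-- The partial derivative with respect to the second parameter `v`. -/
def dv (f : ℝ × ℝ → V) (p : ℝ × ℝ) : V := fderiv ℝ f p (0, 1)

/-- The hyperbolic Laplace operator `∂²/∂u² - ∂²/∂v²`. -/
def hypLaplace (f : ℝ × ℝ → V) (p : ℝ × ℝ) : V := du (du f) p - dv (dv f) p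

end Calculus

/-! First fundamental form of a parametrized surface `z = z(u, v)`. -/

def coeffE (z : ℝ × ℝ → R41) (p : ℝ × ℝ) : ℝ := mink (du z p) (du z p)

def coeffF (z : ℝ × ℝ → R41) (p : ℝ × ℝ) : ℝ := mink (du z p) (dv z p)

def coeffG (z : ℝ × ℝ → R41) (p : ℝ × ℝ) : ℝ := mink (dv z p) (dv z p)

/-- The determinant of the first fundamental form. -/
def gramDet (z : ℝ × ℝ → R41) (p : ℝ × ℝ) : ℝ :=
  coeffE z p * coeffG z p - coeffF z p ^ 2

/-- `z` is a smooth parametrized timelike surface over `D`: the metric induced on the span of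
`z_u, z_v` has signature `(1, 1)`, that is, `E G - F² < 0`. In particular `z_u, z_v` are
linearly independent. -/
def IsTimelike (z : ℝ × ℝ → R41) (D : Set (ℝ × ℝ)) : Prop :=
  ContDiffOn ℝ ∞ z D ∧ ∀ p ∈ D, gramDet z p < 0

/-- The component of `w` normal to the span of `z_u(p), z_v(p)`: the tangential component is
found by solving the Gram system. -/
def normalPart (z : ℝ × ℝ → R41) (p : ℝ × ℝ) (w : R41) : R41 :=
  w - ((coeffG z p * mink w (du z p) - coeffF z p * mink w (dv z p)) / gramDet z p) • du z p
    - ((coeffE z p * mink w (dv z p) - coeffF z p * mink w (du z p)) / gramDet z p) • dv z p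

/-- The second fundamental tensor `σ(dz(a), dz(b))` at `p`, for tangent vectors given by
their coordinates `a, b` in the parameter plane: the normal component of the derivative, in the
direction `a`, of the tangent field `dz(b)`. -/
def sigma (z : ℝ × ℝ → R41) (p a b : ℝ × ℝ) : R41 :=
  normalPart z p (fderiv ℝ (fun q => fderiv ℝ z q b) p a)

/-- The mean curvature vector `H`, half the trace of `σ` with respect to the induced metric. -/
def meanCurvature (z : ℝ × ℝ → R41) (p : ℝ × ℝ) : R41 :=
  (1 / (2 * gramDet z p)) •
    (coeffG z p • sigma z p (1, 0) (1, 0) - (2 * coeffF z p) • sigma z p (1, 0) (0, 1)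
      + coeffE z p • sigma z p (0, 1) (0, 1))

/-- A flat point: the values of the second fundamental tensor span a space of dimension at
most one. -/
def IsFlatPoint (z : ℝ × ℝ → R41) (p : ℝ × ℝ) : Prop :=
  Module.finrank ℝ
    (Submodule.span ℝ (Set.range fun ab : (ℝ × ℝ) × (ℝ × ℝ) => sigma z p ab.1 ab.2)) ≤ 1

/-- `x, y, n₁, n₂` is a geometric frame of the surface at `p`, with geometric functions having
the values `ν, μ` there: `x, y` are tangent, `n₁, n₂` are then normal, and
`σ(x, x) = ν n₁`, `σ(x, y) = μ n₂`, `σ(y, y) = ν n₁`. -/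
def IsGeometricFrameAt (z : ℝ × ℝ → R41) (p : ℝ × ℝ) (ν μ : ℝ) (x y n₁ n₂ : R41) : Prop :=
  IsOrthonormalFrame x y n₁ n₂ ∧
    ∃ a b : ℝ × ℝ, fderiv ℝ z p a = x ∧ fderiv ℝ z p b = y ∧
      sigma z p a a = ν • n₁ ∧ sigma z p a b = μ • n₂ ∧ sigma z p b b = ν • n₁

/-- `x, y, n₁, n₂` is a smooth geometric frame field of the surface over `D`, and `ν, μ` are its
geometric functions. -/
structure IsGeometricFrameField (z : ℝ × ℝ → R41) (D : Set (ℝ × ℝ)) (ν μ : ℝ × ℝ → ℝ)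
    (x y n₁ n₂ : ℝ × ℝ → R41) : Prop where
  smooth_x : ContDiffOn ℝ ∞ x D
  smooth_y : ContDiffOn ℝ ∞ y D
  smooth_n₁ : ContDiffOn ℝ ∞ n₁ D
  smooth_n₂ : ContDiffOn ℝ ∞ n₂ D
  frame : ∀ p ∈ D, IsGeometricFrameAt z p (ν p) (μ p) (x p) (y p) (n₁ p) (n₂ p)

/-- `(u, v)` are canonical parameters, where `x, y` are the canonical tangent fields and `ν, μ`
the geometric functions: the parametric lines are canonical lines, `z_u = √(-E) x` and
`z_v = √G y`, and `-E = G = 1 / √(μ² + ν²)`, `F = 0`. -/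
structure AreCanonicalParameters (z : ℝ × ℝ → R41) (D : Set (ℝ × ℝ)) (ν μ : ℝ × ℝ → ℝ)
    (x y : ℝ × ℝ → R41) : Prop where
  line_u : ∀ p ∈ D, du z p = √(-coeffE z p) • x p
  line_v : ∀ p ∈ D, dv z p = √(coeffG z p) • y p
  E_eq : ∀ p ∈ D, coeffE z p = -(1 / √(μ p ^ 2 + ν p ^ 2))
  F_eq : ∀ p ∈ D, coeffF z p = 0
  G_eq : ∀ p ∈ D, coeffG z p = 1 / √(μ p ^ 2 + ν p ^ 2)

/-- `z` is, over `D`, a timelike surface with zero mean curvature and without flat points, which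
passes through `p₀` at the parameter value `q₀`, has geometric functions `ν, μ`, has
`x₀, y₀, n₁₀, n₂₀` as its geometric frame at `p₀`, and has `(u, v)` as canonical parameters. -/
structure IsSurfaceWithData (μ ν : ℝ × ℝ → ℝ) (D : Set (ℝ × ℝ)) (q₀ : ℝ × ℝ)
    (p₀ x₀ y₀ n₁₀ n₂₀ : R41) (z : ℝ × ℝ → R41) : Prop where
  timelike : IsTimelike z D
  zero_mean_curvature : ∀ p ∈ D, meanCurvature z p = 0
  no_flat_points : ∀ p ∈ D, ¬ IsFlatPoint z p
  passes : z q₀ = p₀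
  geometric : ∃ x y n₁ n₂ : ℝ × ℝ → R41,
    IsGeometricFrameField z D ν μ x y n₁ n₂ ∧
    (x q₀ = x₀ ∧ y q₀ = y₀ ∧ n₁ q₀ = n₁₀ ∧ n₂ q₀ = n₂₀) ∧
    AreCanonicalParameters z D ν μ x y

end TimelikeSurface

end

/-! In canonical parameters a surface of the required kind is governed by a linear total
differential system `dW = Ω W` for the five vectors `W = (x, y, n₁, n₂, z)`. With `λ = √G = exp
(-φ)` and `(ν, μ) = ± exp (2 φ) (cos θ, sin θ)`, every entry of `Ω` is built from `λ`, `α = λ ν`, `β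
= λ μ` and the first derivatives of `φ` and `θ`.

Existence. Because `λ² √(μ² + ν²) = 1`, the two given equations become `Δʰ φ = α² - β²` and `Δʰ θ =
2 α β`. These are the Gauss and Ricci equations of the system. The Codazzi equations and the
symmetry of the second derivatives of `z` hold identically, since `dα = α dφ - β dθ`, `dβ = β dφ + α
dθ` and `dλ = -λ dφ`. So `Ω` is flat (`motionConnection_flat`), and a flat linear system is solvable
near `q₀` with any initial value (`exists_solution_linear_system`). `Ω` is infinitesimally
isometric, so the frame stays orthonormal (`mink_eq_of_skew_connection`), and the surface is then
checked by computing in the frame (`IsMovingFrame.isSurfaceWithData`).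

Uniqueness. Conversely, the geometric frame field of any such surface satisfies this same system
(`isMovingFrame_of_isGeometricFrameField`). Its coefficients are forced by `σ`, by `z_uv = z_vu`,
and by `x_uv = x_vu` after division by `α, β ≠ 0`. A solution of a linear system on a connected open
set is determined by one value (`eqOn_of_linear_system`). -/

section MovingFrames

open scoped ContDiff Topology
open Set Metric

/-! ### Linear total differential systems: uniqueness, regularity, local existence. -/

section LinearSystems

variable {E F V : Type*} [NormedAddCommGroup E] [NormedSpace ℝ E]
  [NormedAddCommGroup F] [NormedSpace ℝ F] [NormedAddCommGroup V] [NormedSpace ℝ V]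

theorem hasDerivAt_comp_ray {W : E → F} {W' : E →L[ℝ] F} {p e : E} {t : ℝ}
    (h : HasFDerivAt W W' (p + t • e)) :
    HasDerivAt (fun s : ℝ => W (p + s • e)) (W' e) t := by
  have h1 : HasDerivAt (fun s : ℝ => p + s • e) e t := by
    simpa using ((hasDerivAt_id t).smul_const e).const_add p
  exact h.comp_hasDerivAt t h1

theorem norm_smul_le_of_mem_Icc {t : ℝ} (ht : t ∈ Icc (0 : ℝ) 1) (e : E) : ‖t • e‖ ≤ ‖e‖ := by
  rw [norm_smul, Real.norm_of_nonneg ht.1]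
  exact mul_le_of_le_one_left (norm_nonneg _) ht.2

/-- A function vanishing at a point, whose derivative is locally bounded by a multiple of the
function, vanishes near that point. -/
theorem eventually_eq_zero_of_norm_fderiv_le {W : E → F} {p : E} {C : ℝ}
    (hd : ∀ᶠ q in 𝓝 p, DifferentiableAt ℝ W q)
    (hb : ∀ᶠ q in 𝓝 p, ‖fderiv ℝ W q‖ ≤ C * ‖W q‖) (hp : W p = 0) :
    ∀ᶠ q in 𝓝 p, W q = 0 := by
  obtain ⟨r, hr, hball⟩ := Metric.eventually_nhds_iff_ball.1 (hd.and hb)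
  refine Metric.eventually_nhds_iff_ball.2 ⟨r, hr, fun q hq => ?_⟩
  have hmem : ∀ t ∈ Icc (0 : ℝ) 1, p + t • (q - p) ∈ ball p r := by
    intro t ht
    rw [mem_ball_iff_norm, add_sub_cancel_left]
    exact (norm_smul_le_of_mem_Icc ht _).trans_lt (mem_ball_iff_norm.1 hq)
  have hder : ∀ t ∈ Icc (0 : ℝ) 1, HasDerivAt (fun s : ℝ => W (p + s • (q - p)))
      (fderiv ℝ W (p + t • (q - p)) (q - p)) t := fun t ht =>
    hasDerivAt_comp_ray (hball _ (hmem t ht)).1.hasFDerivAt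
  have := eq_zero_of_abs_deriv_le_mul_abs_self_of_eq_zero_right (K := C * ‖q - p‖)
    (fun t ht => (hder t ht).continuousAt.continuousWithinAt)
    (fun t ht => (hder t (Ico_subset_Icc_self ht)).hasDerivWithinAt) (by simpa using hp)
    (fun t ht => by
      have h2 := (hball _ (hmem t (Ico_subset_Icc_self ht))).2
      calc _ ≤ ‖fderiv ℝ W (p + t • (q - p))‖ * ‖q - p‖ := ContinuousLinearMap.le_opNorm _ _
        _ ≤ C * ‖W (p + t • (q - p))‖ * ‖q - p‖ := by gcongr
        _ = _ := by ring) 1 (by simp)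
  simpa using this

/-- The zero set is open by the local Gronwall argument and relatively closed by continuity, so it
fills the connected set `D`. -/
theorem eqOn_zero_of_norm_fderiv_le {W : E → F} {D : Set E} (hD : IsOpen D)
    (hc : IsPreconnected D) (hd : DifferentiableOn ℝ W D)
    (hb : ∀ p ∈ D, ∃ C, ∀ᶠ q in 𝓝 p, ‖fderiv ℝ W q‖ ≤ C * ‖W q‖)
    {q₀ : E} (hq₀ : q₀ ∈ D) (h0 : W q₀ = 0) : ∀ p ∈ D, W p = 0 := by
  have hu : IsOpen {p | p ∈ D ∧ W p = 0} := by
    rw [isOpen_iff_mem_nhds]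
    rintro p ⟨hp, hpW⟩
    obtain ⟨C, hC⟩ := hb p hp
    have hDp := hD.mem_nhds hp
    exact Filter.inter_mem hDp (eventually_eq_zero_of_norm_fderiv_le
      (Filter.eventually_of_mem hDp fun q hq => hd.differentiableAt (hD.mem_nhds hq)) hC hpW)
  have hsub := hc.subset_of_closure_inter_subset hu ⟨q₀, hq₀, hq₀, h0⟩ (by
    rintro p ⟨hcl, hp⟩
    refine ⟨hp, ?_⟩
    have hcont : ContinuousAt W p := (hd.differentiableAt (hD.mem_nhds hp)).continuousAt
    have : W p ∈ closure ({0} : Set F) := hcont.continuousWithinAt.mem_closure hcl fun q hq => hq.2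
    simpa using this)
  exact fun p hp => (hsub hp).2

/-- Two solutions of a linear total differential system `dW = Ω W` on a connected open set agree
if they agree at one point. -/
theorem eqOn_of_linear_system {Ω : E → E →L[ℝ] V →L[ℝ] V} {D : Set E} (hD : IsOpen D)
    (hc : IsPreconnected D) (hΩ : ContinuousOn Ω D) {W₁ W₂ : E → V}
    (h₁ : ∀ p ∈ D, HasFDerivAt W₁ ((Ω p).flip (W₁ p)) p)
    (h₂ : ∀ p ∈ D, HasFDerivAt W₂ ((Ω p).flip (W₂ p)) p)
    {q₀ : E} (hq₀ : q₀ ∈ D) (h0 : W₁ q₀ = W₂ q₀) : EqOn W₁ W₂ D := by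
  have hsub : ∀ p ∈ D, HasFDerivAt (W₁ - W₂) ((Ω p).flip ((W₁ - W₂) p)) p := fun p hp => by
    simpa using (h₁ p hp).sub (h₂ p hp)
  have := eqOn_zero_of_norm_fderiv_le (W := W₁ - W₂) hD hc
    (fun p hp => (hsub p hp).differentiableAt.differentiableWithinAt) (fun p hp => by
      refine ⟨‖Ω p‖ + 1, ?_⟩
      have hev : ∀ᶠ q in 𝓝 p, ‖Ω q‖ < ‖Ω p‖ + 1 :=
        have hcont : ContinuousAt Ω p := hΩ.continuousAt (hD.mem_nhds hp)
        have hnorm : Filter.Tendsto (fun q => ‖Ω q‖) (𝓝 p) (𝓝 ‖Ω p‖) :=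
          (continuous_norm (E := E →L[ℝ] V →L[ℝ] V)).continuousAt.tendsto.comp hcont
        hnorm.eventually_lt_const (by linarith)
      filter_upwards [hev, hD.mem_nhds hp] with q hq hqD
      rw [(hsub q hqD).fderiv]
      calc _ ≤ ‖(Ω q).flip‖ * ‖(W₁ - W₂) q‖ := ContinuousLinearMap.le_opNorm _ _
        _ ≤ _ := by rw [ContinuousLinearMap.opNorm_flip]; gcongr) hq₀ (by simp [h0])
  exact fun p hp => sub_eq_zero.1 (this p hp)

theorem contDiff_flip {n : WithTop ℕ∞} :
    ContDiff ℝ n (fun L : E →L[ℝ] V →L[ℝ] V => L.flip) := by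
  apply IsBoundedLinearMap.contDiff
  exact IsLinearMap.with_bound ⟨fun x y => rfl, fun c x => rfl⟩ 1 fun x => by simp

/-- Bootstrapping: the derivative is bilinear in `Ω` and `W`, so it is as smooth as `W` already is,
which gains one order. -/
theorem contDiffOn_of_linear_system {Ω : E → E →L[ℝ] V →L[ℝ] V} {D : Set E} (hD : IsOpen D)
    (hΩ : ContDiffOn ℝ ∞ Ω D) {W : E → V}
    (h : ∀ p ∈ D, HasFDerivAt W ((Ω p).flip (W p)) p) : ContDiffOn ℝ ∞ W D := by
  have hd : DifferentiableOn ℝ W D := fun p hp => (h p hp).differentiableAt.differentiableWithinAt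
  rw [contDiffOn_infty]
  intro n
  induction n with
  | zero => simpa using hd.continuousOn
  | succ n ih =>
    rw [Nat.cast_succ, contDiffOn_succ_iff_fderiv_of_isOpen hD]
    refine ⟨hd, by simp, ?_⟩
    have hflip : ContDiffOn ℝ n (fun p => (Ω p).flip) D :=
      contDiff_flip.comp_contDiffOn (contDiffOn_infty.1 hΩ n)
    exact (hflip.clm_apply ih).congr fun p hp => (h p hp).fderiv

/-- Bounds for a `C²` map, its derivative, and the error of its linearization, uniform on a ball. -/
theorem exists_uniform_taylor_bounds {Ω : E → F} {q₀ : E} {D : Set E} (hD : IsOpen D)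
    (hΩ : ContDiffOn ℝ 2 Ω D) (hq₀ : q₀ ∈ D) :
    ∃ C r : ℝ, 1 ≤ C ∧ 0 < r ∧ ball q₀ r ⊆ D ∧ (∀ p ∈ ball q₀ r, ‖Ω p‖ ≤ C) ∧
      (∀ p ∈ ball q₀ r, ∀ p' ∈ ball q₀ r, ‖Ω p' - Ω p‖ ≤ C * ‖p' - p‖) ∧
      ∀ p ∈ ball q₀ r, ∀ p' ∈ ball q₀ r,
        ‖Ω p' - Ω p - fderiv ℝ Ω p (p' - p)‖ ≤ C * ‖p' - p‖ ^ 2 := by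
  have hat : ContDiffAt ℝ 2 Ω q₀ := hΩ.contDiffAt (hD.mem_nhds hq₀)
  have hat' : ContDiffAt ℝ 1 (fderiv ℝ Ω) q₀ := hat.fderiv_right (by norm_num)
  obtain ⟨K₁, s₁, hs₁, h₁⟩ := (hat.of_le (by norm_num : (1 : WithTop ℕ∞) ≤ 2)).exists_lipschitzOnWith
  obtain ⟨K₂, s₂, hs₂, h₂⟩ := hat'.exists_lipschitzOnWith
  have hev : ∀ᶠ q in 𝓝 q₀, ‖Ω q‖ < ‖Ω q₀‖ + 1 :=
    hat.continuousAt.norm.eventually_lt_const (by linarith)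
  obtain ⟨r, hr, hball⟩ := Metric.mem_nhds_iff.1
    (Filter.inter_mem (hD.mem_nhds hq₀) (Filter.inter_mem hev (Filter.inter_mem hs₁ hs₂)))
  have hK₁ : (0 : ℝ) ≤ K₁ := K₁.2
  have hK₂ : (0 : ℝ) ≤ K₂ := K₂.2
  have hΩ₀ := norm_nonneg (Ω q₀)
  refine ⟨‖Ω q₀‖ + 1 + K₁ + K₂, r, by linarith, hr, fun p hp => (hball hp).1, fun p hp => ?_,
    fun p hp p' hp' => ?_, fun p hp p' hp' => ?_⟩
  · have := (hball hp).2.1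
    rw [mem_ofPred_eq] at this
    linarith
  · calc _ ≤ K₁ * ‖p' - p‖ := by
          simpa [dist_eq_norm] using h₁.dist_le_mul p' (hball hp').2.2.1 p (hball hp).2.2.1
      _ ≤ _ := by gcongr; linarith
  -- The mean value inequality is used on the segment, not on the ball: there the derivative differs
  -- from its value at `p` by at most `K₂ * ‖p' - p‖`, which makes the error quadratic.
  · have hseg : segment ℝ p p' ⊆ ball q₀ r := (convex_ball q₀ r).segment_subset hp hp'
    have hmv := Convex.norm_image_sub_le_of_norm_fderiv_le' (𝕜 := ℝ) (f := Ω) (φ := fderiv ℝ Ω p)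
      (s := segment ℝ p p') (C := K₂ * ‖p' - p‖) (x := p) (y := p')
      (fun x hx => (hΩ.contDiffAt (hD.mem_nhds (hball (hseg hx)).1)).differentiableAt (by norm_num))
      (fun x hx => by
        calc _ ≤ K₂ * ‖x - p‖ := by
              simpa [dist_eq_norm] using
                h₂.dist_le_mul x (hball (hseg hx)).2.2.2 p (hball hp).2.2.2
          _ ≤ _ := by
            gcongr
            exact norm_sub_le_of_mem_segment hx)
      (convex_segment p p') (left_mem_segment ℝ p p') (right_mem_segment ℝ p p')
    calc _ ≤ K₂ * ‖p' - p‖ * ‖p' - p‖ := hmv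
      _ = K₂ * ‖p' - p‖ ^ 2 := by ring
      _ ≤ _ := by gcongr; linarith

/-- Along a short ray the coefficient operator has norm at most `1 / 2`, so a single application of
Picard–Lindelöf covers all of `[0, 1]` and no continuation is needed. -/
theorem exists_radial_solution [CompleteSpace V] {Ω : E → E →L[ℝ] V →L[ℝ] V} {q₀ : E}
    {C r : ℝ} (hr : C * r ≤ 1 / 2) (hC : ∀ p ∈ ball q₀ r, ‖Ω p‖ ≤ C)
    (hΩ : ContinuousOn Ω (ball q₀ r)) (W₀ : V) {e : E} (he : ‖e‖ < r) :
    ∃ Y : ℝ → V, Y 0 = W₀ ∧ ∀ t ∈ Icc (0 : ℝ) 1,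
      HasDerivWithinAt Y (Ω (q₀ + t • e) e (Y t)) (Icc 0 1) t := by
  have hmem : ∀ t ∈ Icc (0 : ℝ) 1, q₀ + t • e ∈ ball q₀ r := fun t ht => by
    rw [mem_ball_iff_norm, add_sub_cancel_left]
    exact (norm_smul_le_of_mem_Icc ht _).trans_lt he
  have hC0 : 0 ≤ C := (norm_nonneg (Ω _)).trans (hC _ (hmem 0 (by simp)))
  have hop : ∀ t ∈ Icc (0 : ℝ) 1, ‖Ω (q₀ + t • e) e‖ ≤ 1 / 2 := fun t ht =>
    calc _ ≤ ‖Ω (q₀ + t • e)‖ * ‖e‖ := ContinuousLinearMap.le_opNorm _ _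
      _ ≤ C * r := by gcongr; exact hC _ (hmem t ht)
      _ ≤ _ := hr
  -- On the ball of radius `‖W₀‖ + 1` about `W₀` the field is at most `(2 ‖W₀‖ + 1) / 2 ≤ ‖W₀‖ + 1`,
  -- so a solution cannot leave that ball within unit time.
  have hpl : IsPicardLindelof (fun t w => Ω (q₀ + t • e) e w) (tmin := 0) (tmax := 1)
      ⟨0, by simp⟩ W₀ (‖W₀‖₊ + 1) 0 (‖W₀‖₊ + 1) (1 / 2) := by
    constructor
    · intro t ht
      have := ((Ω (q₀ + t • e) e).lipschitz.weaken (K' := 1 / 2)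
        (by rw [← NNReal.coe_le_coe]; simpa using hop t ht)).lipschitzOnWith
        (s := closedBall W₀ (‖W₀‖₊ + 1 : NNReal))
      exact this
    · intro w _
      have h1 : ContinuousOn (fun t : ℝ => Ω (q₀ + t • e)) (Icc 0 1) :=
        hΩ.comp (by fun_prop) hmem
      exact (h1.clm_apply continuousOn_const).clm_apply continuousOn_const
    · intro t ht w hw
      have hw' : ‖w‖ ≤ ‖W₀‖ + (‖W₀‖ + 1) := by
        have h1 : ‖w - W₀‖ ≤ ‖W₀‖ + 1 := by simpa [dist_eq_norm] using hw
        have h2 := norm_add_le W₀ (w - W₀)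
        rw [add_sub_cancel] at h2
        linarith
      calc _ ≤ ‖Ω (q₀ + t • e) e‖ * ‖w‖ := ContinuousLinearMap.le_opNorm _ _
        _ ≤ 1 / 2 * (‖W₀‖ + (‖W₀‖ + 1)) := by gcongr; exact hop t ht
        _ ≤ _ := by push_cast; linarith
    · simp
  obtain ⟨Y, h0, hY⟩ := hpl.exists_eq_forall_mem_Icc_hasDerivWithinAt₀
  exact ⟨Y, h0, hY⟩

theorem HasDerivWithinAt.Ici_of_Icc {f : ℝ → V} {f' : V} {t a b : ℝ}
    (h : HasDerivWithinAt f f' (Icc a b) t) (ht : t ∈ Ico a b) :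
    HasDerivWithinAt f f' (Ici t) t :=
  h.mono_of_mem_nhdsWithin (Filter.mem_of_superset (Icc_mem_nhdsGE ht.2)
    (Icc_subset_Icc_left ht.1))

/-- The first order Taylor estimate for the dependence on the direction of the radial solutions
of a flat linear total differential system. -/
theorem norm_radial_solution_sub_le {Ω : E → E →L[ℝ] V →L[ℝ] V} {q₀ : E} {C r B : ℝ}
    (hr : C * r ≤ 1 / 2) (hC : ∀ p ∈ ball q₀ r, ‖Ω p‖ ≤ C)
    (hlip : ∀ p ∈ ball q₀ r, ∀ p' ∈ ball q₀ r, ‖Ω p' - Ω p‖ ≤ C * ‖p' - p‖)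
    (htay : ∀ p ∈ ball q₀ r, ∀ p' ∈ ball q₀ r,
        ‖Ω p' - Ω p - fderiv ℝ Ω p (p' - p)‖ ≤ C * ‖p' - p‖ ^ 2)
    (hr1 : r ≤ 1) (hd : ∀ p ∈ ball q₀ r, DifferentiableAt ℝ Ω p)
    (hflat : ∀ p ∈ ball q₀ r, ∀ h k w,
      fderiv ℝ Ω p h k w + Ω p k (Ω p h w) = fderiv ℝ Ω p k h w + Ω p h (Ω p k w))
    {e e' : E} (he : ‖e‖ < r) (he' : ‖e'‖ < r) {Y Y' : ℝ → V} (h0 : Y 0 = Y' 0)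
    (hY : ∀ t ∈ Icc (0 : ℝ) 1, HasDerivWithinAt Y (Ω (q₀ + t • e) e (Y t)) (Icc 0 1) t)
    (hY' : ∀ t ∈ Icc (0 : ℝ) 1, HasDerivWithinAt Y' (Ω (q₀ + t • e') e' (Y' t)) (Icc 0 1) t)
    (hB : ∀ t ∈ Icc (0 : ℝ) 1, ‖Y t‖ ≤ B) :
    ‖Y' 1 - Y 1 - Ω (q₀ + e) (e' - e) (Y 1)‖ ≤
      (2 * C + 2 * C ^ 2) * B * ‖e' - e‖ ^ 2 * (Real.exp 1 - 1) := by
  have hmem : ∀ e : E, ‖e‖ < r → ∀ t ∈ Icc (0 : ℝ) 1, q₀ + t • e ∈ ball q₀ r := fun e he t ht => by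
    rw [mem_ball_iff_norm, add_sub_cancel_left]
    exact (norm_smul_le_of_mem_Icc ht _).trans_lt he
  have hC0 : 0 ≤ C := (norm_nonneg (Ω _)).trans (hC _ (hmem e he 0 (by simp)))
  have hB0 : 0 ≤ B := (norm_nonneg _).trans (hB 0 (by simp))
  set h := e' - e with hh
  have heq : e' = e + h := by simp [hh]
  -- At time `t` the two rays are `t • h` apart, so the expected first order change of the solution
  -- is `t • Ω h Y`; `δ` is the error of this prediction.
  set δ : ℝ → V := fun t => Y' t - Y t - t • Ω (q₀ + t • e) h (Y t) with hδ
  have hder : ∀ t ∈ Icc (0 : ℝ) 1, HasDerivWithinAt δ (Ω (q₀ + t • e') e' (Y' t)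
      - Ω (q₀ + t • e) e (Y t) - (t • (fderiv ℝ Ω (q₀ + t • e) e h (Y t)
        + Ω (q₀ + t • e) h (Ω (q₀ + t • e) e (Y t))) + (1 : ℝ) • Ω (q₀ + t • e) h (Y t)))
      (Icc 0 1) t := by
    intro t ht
    have h1 : HasDerivAt (fun s : ℝ => Ω (q₀ + s • e)) (fderiv ℝ Ω (q₀ + t • e) e) t :=
      hasDerivAt_comp_ray (F := E →L[ℝ] V →L[ℝ] V) (hd _ (hmem e he t ht)).hasFDerivAt
    have h2 : HasDerivAt (fun s : ℝ => Ω (q₀ + s • e) h) (fderiv ℝ Ω (q₀ + t • e) e h) t := by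
      simpa using h1.clm_apply (hasDerivAt_const t h)
    exact ((hY' t ht).sub (hY t ht)).sub
      ((hasDerivAt_id t).hasDerivWithinAt.smul (h2.hasDerivWithinAt.clm_apply (hY t ht)))
  have hop : ∀ p ∈ ball q₀ r, ∀ k w, ‖Ω p k w‖ ≤ C * ‖k‖ * ‖w‖ := fun p hp k w =>
    ((Ω p).le_opNorm₂ k w).trans (by gcongr; exact hC p hp)
  have hbound : ∀ t ∈ Ico (0 : ℝ) 1, ‖Ω (q₀ + t • e') e' (Y' t)
      - Ω (q₀ + t • e) e (Y t) - (t • (fderiv ℝ Ω (q₀ + t • e) e h (Y t)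
        + Ω (q₀ + t • e) h (Ω (q₀ + t • e) e (Y t))) + (1 : ℝ) • Ω (q₀ + t • e) h (Y t))‖ ≤
      1 * ‖δ t‖ + (2 * C + 2 * C ^ 2) * B * ‖h‖ ^ 2 := by
    intro t ht'
    have ht := Ico_subset_Icc_self ht'
    have hp := hmem e he t ht
    have hp' := hmem e' he' t ht
    set p := q₀ + t • e with hpdef
    set p' := q₀ + t • e' with hpdef'
    have hpp : p' - p = t • h := by rw [hpdef, hpdef', hh, smul_sub]; abel
    have hnt : ‖p' - p‖ ≤ ‖h‖ := by rw [hpp]; exact norm_smul_le_of_mem_Icc ht _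
    have hBt := hB t ht
    -- Flatness exchanges `h` and `e` in the derivative of `Ω`, and the resulting term cancels the
    -- linear part of `Ω p' - Ω p`. What remains is linear in `δ` or quadratic in `h`.
    have hkey : Ω p' e' (Y' t) - Ω p e (Y t) - (t • (fderiv ℝ Ω p e h (Y t)
        + Ω p h (Ω p e (Y t))) + (1 : ℝ) • Ω p h (Y t)) =
        Ω p' e' (δ t) + (Ω p' - Ω p - fderiv ℝ Ω p (p' - p)) e (Y t) + (Ω p' - Ω p) h (Y t)
          + t • ((Ω p' - Ω p) e' (Ω p h (Y t)) + Ω p h (Ω p h (Y t))) := by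
      have hf := hflat p hp e h (Y t)
      have hf' : fderiv ℝ Ω p e h (Y t) =
        fderiv ℝ Ω p h e (Y t) + Ω p e (Ω p h (Y t)) - Ω p h (Ω p e (Y t)) := by
        rw [← hf]; abel
      rw [hf', hpp, hδ]
      simp only [heq, map_add, map_sub, map_smul, add_apply,
        sub_apply, smul_apply, one_smul, smul_add, smul_sub]
      abel
    have hn0 : ‖Ω p' e' (δ t)‖ ≤ 1 * ‖δ t‖ :=
      calc _ ≤ C * ‖e'‖ * ‖δ t‖ := hop p' hp' _ _
        _ ≤ C * r * ‖δ t‖ := by gcongr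
        _ ≤ _ := by gcongr; linarith
    have hn1 : ‖(Ω p' - Ω p - fderiv ℝ Ω p (p' - p)) e (Y t)‖ ≤ C * B * ‖h‖ ^ 2 :=
      calc _ ≤ ‖Ω p' - Ω p - fderiv ℝ Ω p (p' - p)‖ * ‖e‖ * ‖Y t‖ :=
            ContinuousLinearMap.le_opNorm₂ _ _ _
        _ ≤ C * ‖p' - p‖ ^ 2 * 1 * B := by
            gcongr
            · exact htay p hp p' hp'
            · linarith
        _ ≤ C * ‖h‖ ^ 2 * 1 * B := by gcongr
        _ = _ := by ring
    have hlip' : ∀ k w, ‖(Ω p' - Ω p) k w‖ ≤ C * ‖h‖ * ‖k‖ * ‖w‖ := fun k w =>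
      calc _ ≤ ‖Ω p' - Ω p‖ * ‖k‖ * ‖w‖ := ContinuousLinearMap.le_opNorm₂ _ _ _
        _ ≤ C * ‖p' - p‖ * ‖k‖ * ‖w‖ := by gcongr; exact hlip p hp p' hp'
        _ ≤ _ := by gcongr
    have hn2 : ‖(Ω p' - Ω p) h (Y t)‖ ≤ C * B * ‖h‖ ^ 2 :=
      calc _ ≤ C * ‖h‖ * ‖h‖ * ‖Y t‖ := hlip' _ _
        _ ≤ C * ‖h‖ * ‖h‖ * B := by gcongr
        _ = _ := by ring
    have hΩY : ‖Ω p h (Y t)‖ ≤ C * ‖h‖ * B := (hop p hp _ _).trans (by gcongr)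
    have hn3 : ‖t • ((Ω p' - Ω p) e' (Ω p h (Y t)) + Ω p h (Ω p h (Y t)))‖ ≤
        2 * C ^ 2 * B * ‖h‖ ^ 2 :=
      calc _ ≤ ‖(Ω p' - Ω p) e' (Ω p h (Y t)) + Ω p h (Ω p h (Y t))‖ :=
            norm_smul_le_of_mem_Icc ht _
        _ ≤ C * ‖h‖ * ‖e'‖ * ‖Ω p h (Y t)‖ + C * ‖h‖ * ‖Ω p h (Y t)‖ :=
            (norm_add_le _ _).trans (add_le_add (hlip' _ _) (hop p hp _ _))
        _ ≤ C * ‖h‖ * 1 * (C * ‖h‖ * B) + C * ‖h‖ * (C * ‖h‖ * B) := by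
            gcongr
            linarith
        _ = _ := by ring
    rw [hkey]
    calc _ ≤ _ := norm_add₄_le
      _ ≤ 1 * ‖δ t‖ + C * B * ‖h‖ ^ 2 + C * B * ‖h‖ ^ 2 + 2 * C ^ 2 * B * ‖h‖ ^ 2 := by gcongr
      _ = _ := by ring
  -- The rays start from the same value, so the error vanishes at time `0` and Gronwall leaves only
  -- the quadratic forcing.
  have hgr := norm_le_gronwallBound_of_norm_deriv_right_le (δ := 0) (f := δ)
    (fun t ht => (hder t ht).continuousWithinAt)
    (fun t ht => (hder t (Ico_subset_Icc_self ht)).Ici_of_Icc ht) (by simp [hδ, h0]) hbound 1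
    (by simp)
  simpa [gronwallBound_of_K_ne_0 one_ne_zero, hδ] using hgr

/-- **Local solvability of flat linear total differential systems** `dW = Ω W`. -/
theorem exists_solution_linear_system [CompleteSpace V] {Ω : E → E →L[ℝ] V →L[ℝ] V} {q₀ : E}
    {D : Set E} (hD : IsOpen D) (hΩ : ContDiffOn ℝ 2 Ω D) (hq₀ : q₀ ∈ D)
    (hflat : ∀ p ∈ D, ∀ h k w,
      fderiv ℝ Ω p h k w + Ω p k (Ω p h w) = fderiv ℝ Ω p k h w + Ω p h (Ω p k w)) (W₀ : V) :
    ∃ r > 0, ball q₀ r ⊆ D ∧ ∃ W : E → V, W q₀ = W₀ ∧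
      ∀ p ∈ ball q₀ r, HasFDerivAt W ((Ω p).flip (W p)) p := by
  obtain ⟨C, r₀, hC1, hr₀, hball, hC, hlip, htay⟩ := exists_uniform_taylor_bounds hD hΩ hq₀
  obtain ⟨r, hr, hrr₀, hCr, hr1⟩ : ∃ r > 0, r ≤ r₀ ∧ C * r ≤ 1 / 2 ∧ r ≤ 1 := by
    -- The bound `1 / (2 * C)` makes the radial operators have norm at most `1 / 2`; since `1 ≤ C`
    -- it also gives `r ≤ 1`.
    refine ⟨min r₀ (1 / (2 * C)), by positivity, min_le_left _ _, ?_, ?_⟩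
    · calc _ ≤ C * (1 / (2 * C)) := by gcongr; exact min_le_right _ _
        _ = _ := by field_simp
    · refine (min_le_right _ _).trans ?_
      rw [div_le_one (by positivity)]
      linarith
  have hsub : ball q₀ r ⊆ ball q₀ r₀ := ball_subset_ball hrr₀
  have hC' : ∀ p ∈ ball q₀ r, ‖Ω p‖ ≤ C := fun p hp => hC p (hsub hp)
  have hdiff : ∀ p ∈ ball q₀ r, DifferentiableAt ℝ Ω p := fun p hp =>
    (hΩ.contDiffAt (hD.mem_nhds (hball (hsub hp)))).differentiableAt (by norm_num)
  have hex : ∀ e : E, ∃ Y : ℝ → V, Y 0 = W₀ ∧ (‖e‖ < r → ∀ t ∈ Icc (0 : ℝ) 1,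
      HasDerivWithinAt Y (Ω (q₀ + t • e) e (Y t)) (Icc 0 1) t) := fun e => by
    by_cases he : ‖e‖ < r
    · obtain ⟨Y, h0, hY⟩ := exists_radial_solution hCr hC'
        (fun p hp => (hdiff p hp).continuousAt.continuousWithinAt) W₀ he
      exact ⟨Y, h0, fun _ => hY⟩
    -- Directions outside the ball get a constant as a harmless default, so that the choice of `Y`
    -- is total.
    · exact ⟨fun _ => W₀, rfl, fun h => absurd h he⟩
  choose Y hY0 hY using hex
  have hbd : ∀ e, ‖e‖ < r → ∀ t ∈ Icc (0 : ℝ) 1, ‖Y e t‖ ≤ ‖W₀‖ * Real.exp 1 := by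
    intro e he t ht
    have hgr := norm_le_gronwallBound_of_norm_deriv_right_le (f := Y e) (δ := ‖W₀‖) (K := 1) (ε := 0)
      (fun t ht => (hY e he t ht).continuousWithinAt)
      (fun t ht => (hY e he t (Ico_subset_Icc_self ht)).Ici_of_Icc ht) (by rw [hY0])
      (fun s hs => by
        have hmem : q₀ + s • e ∈ ball q₀ r := by
          rw [mem_ball_iff_norm, add_sub_cancel_left]
          exact (norm_smul_le_of_mem_Icc (Ico_subset_Icc_self hs) _).trans_lt he
        calc _ ≤ ‖Ω (q₀ + s • e)‖ * ‖e‖ * ‖Y e s‖ := (Ω _).le_opNorm₂ _ _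
          _ ≤ C * r * ‖Y e s‖ := by gcongr; exact hC' _ hmem
          _ ≤ 1 * ‖Y e s‖ := by gcongr; linarith
          _ = _ := by ring) t ht
    rw [gronwallBound_ε0, one_mul, sub_zero] at hgr
    exact hgr.trans (by gcongr; exact ht.2)
  -- The solution at `p` is the endpoint of the radial solution in the direction `p - q₀`.
  refine ⟨r, hr, hsub.trans hball, fun p => Y (p - q₀) 1, ?_, fun p hp => ?_⟩
  · have hc := constant_of_has_deriv_right_zero (f := Y 0) (a := (0 : ℝ)) (b := 1)
      (fun t ht => (hY 0 (by simpa using hr) t ht).continuousWithinAt)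
      (fun t ht => by
        simpa using (hY 0 (by simpa using hr) t (Ico_subset_Icc_self ht)).Ici_of_Icc ht) 1 (by simp)
    simp [hc, hY0]
  · have hpr : ‖p - q₀‖ < r := mem_ball_iff_norm.1 hp
    set K := (2 * C + 2 * C ^ 2) * (‖W₀‖ * Real.exp 1)
    -- The quadratic estimate gives the remainder derivative zero, so differentiability of `W` and
    -- the equation `dW = Ω W` come out together.
    have hO : (fun p' => Y (p' - q₀) 1 - Y (p - q₀) 1 - Ω p (p' - p) (Y (p - q₀) 1))
        =O[𝓝 p] fun p' => ‖p' - p‖ ^ 2 := by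
      refine Asymptotics.IsBigO.of_bound (K * (Real.exp 1 - 1)) ?_
      filter_upwards [isOpen_ball.mem_nhds hp] with p' hp'
      have := norm_radial_solution_sub_le hCr hC' (fun a ha b hb => hlip a (hsub ha) b (hsub hb))
        (fun a ha b hb => htay a (hsub ha) b (hsub hb)) hr1 hdiff
        (fun a ha => hflat a (hball (hsub ha))) hpr (mem_ball_iff_norm.1 hp')
        ((hY0 _).trans (hY0 _).symm) (hY _ hpr) (hY _ (mem_ball_iff_norm.1 hp')) (hbd _ hpr)
      rw [add_sub_cancel, sub_sub_sub_cancel_right] at this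
      refine this.trans (le_of_eq ?_)
      rw [norm_pow, norm_norm]
      ring
    have h0 := hO.hasFDerivAt (𝕜 := ℝ) (by norm_num)
    have h1 : HasFDerivAt (fun p' => Ω p (p' - p) (Y (p - q₀) 1))
        ((Ω p).flip (Y (p - q₀) 1)) p :=
      ((Ω p).flip (Y (p - q₀) 1)).hasFDerivAt.comp p ((hasFDerivAt_id p).sub_const p)
    have h2 := (h0.add h1).add_const (Y (p - q₀) 1)
    rw [zero_add] at h2
    refine h2.congr_of_eventuallyEq (Filter.Eventually.of_forall fun p' => ?_)
    simp

end LinearSystems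

/-! ### Operators defined by matrices of one-forms. -/

section Connection

variable {E G ι : Type*} [NormedAddCommGroup E] [NormedSpace ℝ E]
  [NormedAddCommGroup G] [NormedSpace ℝ G] [Fintype ι]

/-- The operator-valued one-form on `ι → G` given by a matrix of one-forms. -/
noncomputable def connectionOp [DecidableEq ι] (m : ι → ι → E →L[ℝ] ℝ) :
    E →L[ℝ] (ι → G) →L[ℝ] (ι → G) :=
  ∑ i, ∑ j, (m i j).smulRight
    ((ContinuousLinearMap.single ℝ (fun _ : ι => G) i).comp (ContinuousLinearMap.proj j))

theorem connectionOp_apply [DecidableEq ι] (m : ι → ι → E →L[ℝ] ℝ) (h : E) (w : ι → G) (i : ι) :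
    connectionOp (G := G) m h w i = ∑ j, m i j h • w j := by
  simp [connectionOp, sum_apply, Finset.sum_apply, Pi.single_apply, smul_ite]

theorem contDiffOn_connectionOp [DecidableEq ι] {m : E → ι → ι → E →L[ℝ] ℝ} {D : Set E}
    {n : WithTop ℕ∞} (hm : ∀ i j, ContDiffOn ℝ n (fun p => m p i j) D) :
    ContDiffOn ℝ n (fun p => connectionOp (G := G) (m p)) D := by
  unfold connectionOp
  exact ContDiffOn.sum fun i _ => ContDiffOn.sum fun j _ => (hm i j).smulRight contDiffOn_const

theorem exists_hasFDerivAt_apply_apply {V : Type*} [NormedAddCommGroup V] [NormedSpace ℝ V]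
    {Ω : E → E →L[ℝ] V →L[ℝ] V} {Ω' : E →L[ℝ] E →L[ℝ] V →L[ℝ] V} {p : E}
    (h : HasFDerivAt Ω Ω' p) (k : E) (w : V) :
    ∃ L : E →L[ℝ] V, HasFDerivAt (fun q => Ω q k w) L p ∧ ∀ e, L e = Ω' e k w :=
  ⟨_, (h.clm_apply (hasFDerivAt_const k p)).clm_apply (hasFDerivAt_const w p), fun e => by simp⟩

theorem fderiv_connectionOp [DecidableEq ι] {m : E → ι → ι → E →L[ℝ] ℝ} {p : E}
    {m' : ι → ι → E →L[ℝ] E →L[ℝ] ℝ} (hm : ∀ i j, HasFDerivAt (fun p => m p i j) (m' i j) p)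
    (hd : DifferentiableAt ℝ (fun p => connectionOp (G := G) (m p)) p) (h k : E) (w : ι → G) (i : ι) :
    fderiv ℝ (fun p => connectionOp (G := G) (m p)) p h k w i = ∑ j, m' i j h k • w j := by
  have h1 : HasFDerivAt (fun q => connectionOp (G := G) (m q) k w i)
      (∑ j, ((m' i j).flip k).smulRight (w j)) p := by
    simp only [connectionOp_apply]
    refine HasFDerivAt.fun_sum fun j _ => ?_
    have := ((hm i j).clm_apply (hasFDerivAt_const k p)).smul_const (w j)
    simpa using this
  obtain ⟨L, hL, hLe⟩ := exists_hasFDerivAt_apply_apply hd.hasFDerivAt k w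
  rw [← hLe, ← ContinuousLinearMap.proj_apply (R := ℝ) (φ := fun _ : ι => G) i (L h),
    ← ContinuousLinearMap.comp_apply, (hasFDerivAt_pi'.1 hL i).unique h1]
  simp [sum_apply]

/-- The coefficient of each `w l` is compared on both sides, which reduces flatness of the operator
to the vanishing of the curvature of the matrix, entry by entry. -/
theorem connectionOp_flat [DecidableEq ι] {m : E → ι → ι → E →L[ℝ] ℝ} {p : E}
    {m' : ι → ι → E →L[ℝ] E →L[ℝ] ℝ} (hm : ∀ i j, HasFDerivAt (fun p => m p i j) (m' i j) p)
    (hd : DifferentiableAt ℝ (fun p => connectionOp (G := G) (m p)) p) (h k : E)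
    (hflat : ∀ i l, m' i l h k + ∑ j, m p i j k * m p j l h =
      m' i l k h + ∑ j, m p i j h * m p j l k) (w : ι → G) :
    fderiv ℝ (fun p => connectionOp (G := G) (m p)) p h k w
        + connectionOp (G := G) (m p) k (connectionOp (G := G) (m p) h w) =
      fderiv ℝ (fun p => connectionOp (G := G) (m p)) p k h w
        + connectionOp (G := G) (m p) h (connectionOp (G := G) (m p) k w) := by
  have key : ∀ h k i, (fderiv ℝ (fun p => connectionOp (G := G) (m p)) p h k w
        + connectionOp (G := G) (m p) k (connectionOp (G := G) (m p) h w)) i =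
      ∑ l, (m' i l h k + ∑ j, m p i j k * m p j l h) • w l := by
    intro h k i
    simp only [Pi.add_apply, fderiv_connectionOp hm hd, connectionOp_apply, add_smul,
      Finset.sum_add_distrib, Finset.smul_sum, Finset.sum_smul, mul_smul]
    rw [Finset.sum_comm]
  ext1 i
  rw [key, key]
  exact Finset.sum_congr rfl fun l _ => by rw [hflat]

end Connection

/-! ### The structure equations of a frame together with its position vector. -/

section FrameMatrix

/-- The coefficient matrix of the equations of motion of a frame `x, y, n₁, n₂` (with `x`
timelike) and of the position vector, the latter moving in the direction of `x` and `y`. -/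
def frameMatrix {A : Type*} [Zero A] [Neg A] (P Q R S T U a b : A) : Fin 5 → Fin 5 → A :=
  ![![0, P, Q, R, 0], ![P, 0, S, T, 0], ![Q, -S, 0, U, 0], ![R, -T, -U, 0, 0], ![a, b, 0, 0, 0]]

variable {E A : Type*} [NormedAddCommGroup E] [NormedSpace ℝ E]
  [NormedAddCommGroup A] [NormedSpace ℝ A]

theorem contDiffOn_frameMatrix {D : Set E} {n : WithTop ℕ∞} {P Q R S T U a b : E → A}
    (hP : ContDiffOn ℝ n P D) (hQ : ContDiffOn ℝ n Q D) (hR : ContDiffOn ℝ n R D)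
    (hS : ContDiffOn ℝ n S D) (hT : ContDiffOn ℝ n T D) (hU : ContDiffOn ℝ n U D)
    (ha : ContDiffOn ℝ n a D) (hb : ContDiffOn ℝ n b D) (i j : Fin 5) :
    ContDiffOn ℝ n (fun p => frameMatrix (P p) (Q p) (R p) (S p) (T p) (U p) (a p) (b p) i j) D := by
  fin_cases i <;> fin_cases j <;> first
    | exact contDiffOn_const | assumption | exact hS.neg | exact hT.neg | exact hU.neg

theorem hasFDerivAt_frameMatrix {p : E} {P Q R S T U a b : E → A}
    {P' Q' R' S' T' U' a' b' : E →L[ℝ] A}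
    (hP : HasFDerivAt P P' p) (hQ : HasFDerivAt Q Q' p) (hR : HasFDerivAt R R' p)
    (hS : HasFDerivAt S S' p) (hT : HasFDerivAt T T' p) (hU : HasFDerivAt U U' p)
    (ha : HasFDerivAt a a' p) (hb : HasFDerivAt b b' p) (i j : Fin 5) :
    HasFDerivAt (fun p => frameMatrix (P p) (Q p) (R p) (S p) (T p) (U p) (a p) (b p) i j)
      (frameMatrix P' Q' R' S' T' U' a' b' i j) p := by
  fin_cases i <;> fin_cases j <;> first
    | exact hasFDerivAt_const _ _ | assumption | exact hS.neg | exact hT.neg | exact hU.neg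

/-- Skewness with respect to the signature makes the entries below the diagonal of the frame block
repeat those above it. This leaves Gauss (`hP`), Codazzi (`hQ`, `hR`, `hS`, `hT`) and Ricci (`hU`).
The position row adds the vanishing of torsion (`ha`, `hb`) and the symmetry of the second
fundamental form (`h₁`, `h₂`). -/
theorem frameMatrix_flat {P Q R S T U a b : E →L[ℝ] ℝ} {P' Q' R' S' T' U' a' b' : E →L[ℝ] E →L[ℝ] ℝ}
    {h k : E}
    (hP : P' h k - Q k * S h - R k * T h = P' k h - Q h * S k - R h * T k)
    (hQ : Q' h k + P k * S h - R k * U h = Q' k h + P h * S k - R h * U k)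
    (hR : R' h k + P k * T h + Q k * U h = R' k h + P h * T k + Q h * U k)
    (hS : S' h k + P k * Q h - T k * U h = S' k h + P h * Q k - T h * U k)
    (hT : T' h k + P k * R h + S k * U h = T' k h + P h * R k + S h * U k)
    (hU : U' h k + Q k * R h - S k * T h = U' k h + Q h * R k - S h * T k)
    (ha : a' h k + b k * P h = a' k h + b h * P k)
    (hb : b' h k + a k * P h = b' k h + a h * P k)
    (h₁ : a k * Q h + b k * S h = a h * Q k + b h * S k)
    (h₂ : a k * R h + b k * T h = a h * R k + b h * T k) (i l : Fin 5) :
    frameMatrix P' Q' R' S' T' U' a' b' i l h k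
        + ∑ j, frameMatrix P Q R S T U a b i j k * frameMatrix P Q R S T U a b j l h =
      frameMatrix P' Q' R' S' T' U' a' b' i l k h
        + ∑ j, frameMatrix P Q R S T U a b i j h * frameMatrix P Q R S T U a b j l k := by
  fin_cases i <;> fin_cases l <;> simp [frameMatrix, Fin.sum_univ_five] <;> linarith

end FrameMatrix

namespace TimelikeSurface

/-! ### Partial derivatives of smooth maps of two parameters. -/

section Calculus

variable {V : Type*} [NormedAddCommGroup V] [NormedSpace ℝ V]

theorem fderiv_apply_eq_du_dv (f : ℝ × ℝ → V) (p h : ℝ × ℝ) :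
    fderiv ℝ f p h = h.1 • du f p + h.2 • dv f p := by
  have : h = h.1 • ((1, 0) : ℝ × ℝ) + h.2 • ((0, 1) : ℝ × ℝ) := by ext <;> simp
  conv_lhs => rw [this, map_add, map_smul, map_smul]
  rfl

theorem contDiffOn_fderiv_apply {f : ℝ × ℝ → V} {D : Set (ℝ × ℝ)} (hD : IsOpen D)
    (hf : ContDiffOn ℝ ∞ f D) (h : ℝ × ℝ) : ContDiffOn ℝ ∞ (fun p => fderiv ℝ f p h) D :=
  ((contDiffOn_infty_iff_fderiv_of_isOpen hD).1 hf).2.clm_apply contDiffOn_const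

theorem contDiffOn_du {f : ℝ × ℝ → V} {D : Set (ℝ × ℝ)} (hD : IsOpen D)
    (hf : ContDiffOn ℝ ∞ f D) : ContDiffOn ℝ ∞ (du f) D :=
  contDiffOn_fderiv_apply hD hf _

theorem contDiffOn_dv {f : ℝ × ℝ → V} {D : Set (ℝ × ℝ)} (hD : IsOpen D)
    (hf : ContDiffOn ℝ ∞ f D) : ContDiffOn ℝ ∞ (dv f) D :=
  contDiffOn_fderiv_apply hD hf _

theorem differentiableAt_of_smooth {f : ℝ × ℝ → V} {D : Set (ℝ × ℝ)} (hD : IsOpen D)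
    (hf : ContDiffOn ℝ ∞ f D) {p : ℝ × ℝ} (hp : p ∈ D) : DifferentiableAt ℝ f p :=
  (hf.contDiffAt (hD.mem_nhds hp)).differentiableAt (by simp)

theorem fderiv_fderiv_apply {f : ℝ × ℝ → V} {D : Set (ℝ × ℝ)} (hD : IsOpen D)
    (hf : ContDiffOn ℝ ∞ f D) {p : ℝ × ℝ} (hp : p ∈ D) (h k : ℝ × ℝ) :
    fderiv ℝ (fun q => fderiv ℝ f q k) p h = fderiv ℝ (fderiv ℝ f) p h k := by
  have hd : DifferentiableAt ℝ (fderiv ℝ f) p :=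
    ((((contDiffOn_infty_iff_fderiv_of_isOpen hD).1 hf).2).contDiffAt
      (hD.mem_nhds hp)).differentiableAt (by simp)
  have := hd.hasFDerivAt.clm_apply (hasFDerivAt_const k p)
  rw [this.fderiv]
  simp

theorem fderiv_fderiv_comm {f : ℝ × ℝ → V} {D : Set (ℝ × ℝ)} (hD : IsOpen D)
    (hf : ContDiffOn ℝ ∞ f D) {p : ℝ × ℝ} (hp : p ∈ D) (h k : ℝ × ℝ) :
    fderiv ℝ (fderiv ℝ f) p h k = fderiv ℝ (fderiv ℝ f) p k h :=
  ((hf.contDiffAt (hD.mem_nhds hp)).isSymmSndFDerivAt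
    (by rw [minSmoothness_of_isRCLikeNormedField]; exact WithTop.coe_le_coe.2 (le_top (a := (2 : ℕ∞))))).eq h k

theorem dv_du_eq_du_dv {f : ℝ × ℝ → V} {D : Set (ℝ × ℝ)} (hD : IsOpen D)
    (hf : ContDiffOn ℝ ∞ f D) {p : ℝ × ℝ} (hp : p ∈ D) : dv (du f) p = du (dv f) p := by
  unfold du dv
  rw [fderiv_fderiv_apply hD hf hp, fderiv_fderiv_apply hD hf hp, fderiv_fderiv_comm hD hf hp]

end Calculus

/-- The functions governing the equations of motion of the frame: `lam = √G`, the polar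
coordinates `exp (2 φ), θ` of `(ν, μ)`, and `α = lam ν`, `β = lam μ`. -/
structure IsMotionData (D : Set (ℝ × ℝ)) (φ θ α β lam : ℝ × ℝ → ℝ) : Prop where
  smooth_φ : ContDiffOn ℝ ∞ φ D
  smooth_θ : ContDiffOn ℝ ∞ θ D
  smooth_α : ContDiffOn ℝ ∞ α D
  smooth_β : ContDiffOn ℝ ∞ β D
  smooth_lam : ContDiffOn ℝ ∞ lam D
  fderiv_α : ∀ p ∈ D, ∀ h, fderiv ℝ α p h = α p * fderiv ℝ φ p h - β p * fderiv ℝ θ p h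
  fderiv_β : ∀ p ∈ D, ∀ h, fderiv ℝ β p h = β p * fderiv ℝ φ p h + α p * fderiv ℝ θ p h
  fderiv_lam : ∀ p ∈ D, ∀ h, fderiv ℝ lam p h = -(lam p * fderiv ℝ φ p h)
  lam_pos : ∀ p ∈ D, 0 < lam p
  α_ne : ∀ p ∈ D, α p ≠ 0
  β_ne : ∀ p ∈ D, β p ≠ 0
  hypLaplace_φ : ∀ p ∈ D, hypLaplace φ p = α p ^ 2 - β p ^ 2
  hypLaplace_θ : ∀ p ∈ D, hypLaplace θ p = 2 * α p * β p

theorem IsMotionData.mono {D D' : Set (ℝ × ℝ)} {φ θ α β lam : ℝ × ℝ → ℝ}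
    (H : IsMotionData D φ θ α β lam) (h : D' ⊆ D) : IsMotionData D' φ θ α β lam where
  smooth_φ := H.smooth_φ.mono h
  smooth_θ := H.smooth_θ.mono h
  smooth_α := H.smooth_α.mono h
  smooth_β := H.smooth_β.mono h
  smooth_lam := H.smooth_lam.mono h
  fderiv_α p hp := H.fderiv_α p (h hp)
  fderiv_β p hp := H.fderiv_β p (h hp)
  fderiv_lam p hp := H.fderiv_lam p (h hp)
  lam_pos p hp := H.lam_pos p (h hp)
  α_ne p hp := H.α_ne p (h hp)
  β_ne p hp := H.β_ne p (h hp)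
  hypLaplace_φ p hp := H.hypLaplace_φ p (h hp)
  hypLaplace_θ p hp := H.hypLaplace_θ p (h hp)

/-- The logarithmic radius of `(ν, μ)`, normalised so that `√G = exp (-logRadius)`. -/
noncomputable def logRadius (μ ν : ℝ × ℝ → ℝ) (q : ℝ × ℝ) : ℝ :=
  Real.log ((μ q ^ 2 + ν q ^ 2) ^ (1 / 4 : ℝ))

/-- The polar angle of `(ν, μ)`, up to a multiple of `π`. -/
noncomputable def angle (μ ν : ℝ × ℝ → ℝ) (q : ℝ × ℝ) : ℝ := Real.arctan (μ q / ν q)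

/-- The common length `√(-E) = √G` of `z_u` and `z_v` in canonical parameters. -/
noncomputable def scale (μ ν : ℝ × ℝ → ℝ) (q : ℝ × ℝ) : ℝ := Real.exp (-logRadius μ ν q)

theorem add_sq_pos_of_mul_ne_zero {a b : ℝ} (h : a * b ≠ 0) : 0 < a ^ 2 + b ^ 2 := by
  have := left_ne_zero_of_mul h
  positivity

theorem logRadius_eq {μ ν : ℝ × ℝ → ℝ} {q : ℝ × ℝ} (h : μ q * ν q ≠ 0) :
    logRadius μ ν q = 1 / 4 * Real.log (μ q ^ 2 + ν q ^ 2) :=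
  Real.log_rpow (add_sq_pos_of_mul_ne_zero h) _

theorem scale_sq {μ ν : ℝ × ℝ → ℝ} {q : ℝ × ℝ} (h : μ q * ν q ≠ 0) :
    scale μ ν q ^ 2 = 1 / √(μ q ^ 2 + ν q ^ 2) := by
  have hpos := add_sq_pos_of_mul_ne_zero h
  have h1 : √(μ q ^ 2 + ν q ^ 2) = Real.exp (2 * logRadius μ ν q) := by
    rw [Real.sqrt_eq_rpow, Real.rpow_def_of_pos hpos, logRadius_eq h]
    ring_nf
  rw [h1, scale, one_div, ← Real.exp_neg, ← Real.exp_nat_mul]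
  congr 1
  push_cast
  ring

/-- With `r² = μ² + ν²`, one has `dφ = (μ dμ + ν dν) / (2 r²)` and `dθ = (ν dμ - μ dν) / r²`; the
two formulas invert this linear system. The ambiguity of `π` in the angle does not affect
derivatives. -/
theorem fderiv_polar {μ ν : ℝ × ℝ → ℝ} {p : ℝ × ℝ} (hμ : DifferentiableAt ℝ μ p)
    (hν : DifferentiableAt ℝ ν p) (hne : ∀ᶠ q in 𝓝 p, μ q * ν q ≠ 0) (h : ℝ × ℝ) :
    fderiv ℝ μ p h = 2 * μ p * fderiv ℝ (logRadius μ ν) p h + ν p * fderiv ℝ (angle μ ν) p h ∧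
    fderiv ℝ ν p h = 2 * ν p * fderiv ℝ (logRadius μ ν) p h - μ p * fderiv ℝ (angle μ ν) p h := by
  have hp : μ p * ν p ≠ 0 := hne.self_of_nhds
  have hpos := add_sq_pos_of_mul_ne_zero hp
  have hν0 : ν p ≠ 0 := right_ne_zero_of_mul hp
  have hφ : HasFDerivAt (logRadius μ ν) _ p :=
    ((((hμ.hasFDerivAt.pow 2).add (hν.hasFDerivAt.pow 2)).log hpos.ne').const_mul
      (1 / 4)).congr_of_eventuallyEq (hne.mono fun q hq => logRadius_eq hq)
  have hθ : HasFDerivAt (angle μ ν) _ p :=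
    (hμ.hasFDerivAt.mul ((hasDerivAt_inv hν0).comp_hasFDerivAt p hν.hasFDerivAt)).arctan
      |>.congr_of_eventuallyEq
      (Filter.Eventually.of_forall fun q => by simp [angle, div_eq_mul_inv])
  rw [hφ.fderiv, hθ.fderiv]
  have h2 : ν p ^ 2 + μ p ^ 2 ≠ 0 := by rw [add_comm]; exact hpos.ne'
  have h3 : 1 + (μ p / ν p) ^ 2 ≠ 0 := by positivity
  constructor <;> simp <;> field_simp <;> ring

/-- The normalisation `scale² * (μ² + ν²) ^ (1 / 2) = 1` absorbs the factor in front of both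
hyperbolic Laplacians. -/
theorem isMotionData {μ ν : ℝ × ℝ → ℝ} {D : Set (ℝ × ℝ)} (hD : IsOpen D)
    (hμ : ContDiffOn ℝ ∞ μ D) (hν : ContDiffOn ℝ ∞ ν D) (hμν : ∀ p ∈ D, μ p * ν p ≠ 0)
    (h₁ : ∀ p ∈ D, (μ p ^ 2 + ν p ^ 2) ^ (1 / 2 : ℝ) *
      hypLaplace (fun q => Real.log ((μ q ^ 2 + ν q ^ 2) ^ (1 / 4 : ℝ))) p = ν p ^ 2 - μ p ^ 2)
    (h₂ : ∀ p ∈ D, (μ p ^ 2 + ν p ^ 2) ^ (1 / 2 : ℝ) *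
      hypLaplace (fun q => Real.arctan (μ q / ν q)) p = 2 * ν p * μ p) :
    IsMotionData D (logRadius μ ν) (angle μ ν) (fun p => scale μ ν p * ν p)
      (fun p => scale μ ν p * μ p) (scale μ ν) := by
  have hsφ : ContDiffOn ℝ ∞ (logRadius μ ν) D := by
    have : ContDiffOn ℝ ∞ (fun q => 1 / 4 * Real.log (μ q ^ 2 + ν q ^ 2)) D :=
      contDiffOn_const.mul (((hμ.pow 2).add (hν.pow 2)).log
        fun p hp => (add_sq_pos_of_mul_ne_zero (hμν p hp)).ne')
    exact this.congr fun p hp => logRadius_eq (hμν p hp)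
  have hsθ : ContDiffOn ℝ ∞ (angle μ ν) D :=
    (hμ.div hν fun p hp => right_ne_zero_of_mul (hμν p hp)).arctan
  have hsl : ContDiffOn ℝ ∞ (scale μ ν) D := hsφ.neg.exp
  have hlam : ∀ p ∈ D, HasFDerivAt (scale μ ν) (Real.exp (-logRadius μ ν p) •
      -fderiv ℝ (logRadius μ ν) p) p := fun p hp =>
    (differentiableAt_of_smooth hD hsφ hp).hasFDerivAt.neg.exp
  have hlam' : ∀ p ∈ D, ∀ h, fderiv ℝ (scale μ ν) p h =
      -(scale μ ν p * fderiv ℝ (logRadius μ ν) p h) := fun p hp h => by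
    rw [(hlam p hp).fderiv]
    simp [scale]
  have hpol : ∀ p ∈ D, ∀ h, _ := fun p hp h =>
    fderiv_polar (differentiableAt_of_smooth hD hμ hp) (differentiableAt_of_smooth hD hν hp)
      (Filter.eventually_of_mem (hD.mem_nhds hp) hμν) h
  have hprod : ∀ f : ℝ × ℝ → ℝ, ContDiffOn ℝ ∞ f D → ∀ p ∈ D, ∀ h,
      fderiv ℝ (fun p => scale μ ν p * f p) p h =
        scale μ ν p * fderiv ℝ f p h + f p * fderiv ℝ (scale μ ν) p h := fun f hf p hp h => by
    rw [fderiv_fun_mul (differentiableAt_of_smooth hD hsl hp) (differentiableAt_of_smooth hD hf hp)]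
    simp
  have hsq : ∀ p ∈ D, scale μ ν p ^ 2 * (μ p ^ 2 + ν p ^ 2) ^ (1 / 2 : ℝ) = 1 := fun p hp => by
    have := add_sq_pos_of_mul_ne_zero (hμν p hp)
    rw [scale_sq (hμν p hp), ← Real.sqrt_eq_rpow]
    field_simp
  refine ⟨hsφ, hsθ, hsl.mul hν, hsl.mul hμ, hsl, fun p hp h => ?_, fun p hp h => ?_, hlam',
    fun p _ => Real.exp_pos _,
    fun p hp => mul_ne_zero (Real.exp_pos _).ne' (right_ne_zero_of_mul (hμν p hp)),
    fun p hp => mul_ne_zero (Real.exp_pos _).ne' (left_ne_zero_of_mul (hμν p hp)),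
    fun p hp => ?_, fun p hp => ?_⟩
  · rw [hprod ν hν p hp, (hpol p hp h).2, hlam' p hp]
    ring
  · rw [hprod μ hμ p hp, (hpol p hp h).1, hlam' p hp]
    ring
  · have e : hypLaplace (logRadius μ ν) p = (scale μ ν p ^ 2 * (μ p ^ 2 + ν p ^ 2) ^ (1 / 2 : ℝ)) *
      hypLaplace (logRadius μ ν) p := by rw [hsq p hp, one_mul]
    have e' := h₁ p hp
    change _ * hypLaplace (logRadius μ ν) p = _ at e'
    rw [e, mul_assoc, e']
    ring
  · have e : hypLaplace (angle μ ν) p = (scale μ ν p ^ 2 * (μ p ^ 2 + ν p ^ 2) ^ (1 / 2 : ℝ)) *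
      hypLaplace (angle μ ν) p := by rw [hsq p hp, one_mul]
    have e' := h₂ p hp
    change _ * hypLaplace (angle μ ν) p = _ at e'
    rw [e, mul_assoc, e']
    ring

/-- The matrix of one-forms of the equations of motion. -/
noncomputable def motionForms (φ θ α β lam : ℝ × ℝ → ℝ) (p : ℝ × ℝ) :
    Fin 5 → Fin 5 → ℝ × ℝ →L[ℝ] ℝ :=
  frameMatrix
    (-(dv φ p • ContinuousLinearMap.fst ℝ ℝ ℝ + du φ p • ContinuousLinearMap.snd ℝ ℝ ℝ))
    (α p • ContinuousLinearMap.fst ℝ ℝ ℝ) (β p • ContinuousLinearMap.snd ℝ ℝ ℝ)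
    (α p • ContinuousLinearMap.snd ℝ ℝ ℝ) (β p • ContinuousLinearMap.fst ℝ ℝ ℝ)
    (dv θ p • ContinuousLinearMap.fst ℝ ℝ ℝ + du θ p • ContinuousLinearMap.snd ℝ ℝ ℝ)
    (lam p • ContinuousLinearMap.fst ℝ ℝ ℝ) (lam p • ContinuousLinearMap.snd ℝ ℝ ℝ)

/-- The operator-valued one-form of the equations of motion. -/
noncomputable def motionConnection (φ θ α β lam : ℝ × ℝ → ℝ) (p : ℝ × ℝ) :
    ℝ × ℝ →L[ℝ] (Fin 5 → R41) →L[ℝ] (Fin 5 → R41) :=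
  connectionOp (motionForms φ θ α β lam p)

/-! ### The equations of motion: flatness and solutions. -/

section

variable {D : Set (ℝ × ℝ)} {φ θ α β lam : ℝ × ℝ → ℝ}

theorem contDiffOn_motionConnection (hD : IsOpen D) (H : IsMotionData D φ θ α β lam) :
    ContDiffOn ℝ ∞ (motionConnection φ θ α β lam) D := by
  have hφu := contDiffOn_du hD H.smooth_φ
  have hφv := contDiffOn_dv hD H.smooth_φ
  have hθu := contDiffOn_du hD H.smooth_θ
  have hθv := contDiffOn_dv hD H.smooth_θ
  have hα := H.smooth_α
  have hβ := H.smooth_β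
  have hl := H.smooth_lam
  exact contDiffOn_connectionOp (contDiffOn_frameMatrix (by fun_prop) (by fun_prop) (by fun_prop)
    (by fun_prop) (by fun_prop) (by fun_prop) (by fun_prop) (by fun_prop))

/-- This is where the two differential equations enter: once for Gauss and once for Ricci. The other
structure equations are identities in the first derivatives of `φ` and `θ`. -/
theorem motionConnection_flat (hD : IsOpen D) (H : IsMotionData D φ θ α β lam) {p : ℝ × ℝ}
    (hp : p ∈ D) (h k : ℝ × ℝ) (w : Fin 5 → R41) :
    fderiv ℝ (motionConnection φ θ α β lam) p h k w
        + motionConnection φ θ α β lam p k (motionConnection φ θ α β lam p h w) =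
      fderiv ℝ (motionConnection φ θ α β lam) p k h w
        + motionConnection φ θ α β lam p h (motionConnection φ θ α β lam p k w) := by
  have hd : DifferentiableAt ℝ (motionConnection φ θ α β lam) p :=
    ((contDiffOn_motionConnection hD H).contDiffAt (hD.mem_nhds hp)).differentiableAt (by simp)
  have hα := (differentiableAt_of_smooth hD H.smooth_α hp).hasFDerivAt
  have hβ := (differentiableAt_of_smooth hD H.smooth_β hp).hasFDerivAt
  have hl := (differentiableAt_of_smooth hD H.smooth_lam hp).hasFDerivAt
  have hφu := (differentiableAt_of_smooth hD (contDiffOn_du hD H.smooth_φ) hp).hasFDerivAt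
  have hφv := (differentiableAt_of_smooth hD (contDiffOn_dv hD H.smooth_φ) hp).hasFDerivAt
  have hθu := (differentiableAt_of_smooth hD (contDiffOn_du hD H.smooth_θ) hp).hasFDerivAt
  have hθv := (differentiableAt_of_smooth hD (contDiffOn_dv hD H.smooth_θ) hp).hasFDerivAt
  have hm := hasFDerivAt_frameMatrix
    (((hφv.smul_const (ContinuousLinearMap.fst ℝ ℝ ℝ)).add
      (hφu.smul_const (ContinuousLinearMap.snd ℝ ℝ ℝ))).neg)
    (hα.smul_const (ContinuousLinearMap.fst ℝ ℝ ℝ)) (hβ.smul_const (ContinuousLinearMap.snd ℝ ℝ ℝ))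
    (hα.smul_const (ContinuousLinearMap.snd ℝ ℝ ℝ)) (hβ.smul_const (ContinuousLinearMap.fst ℝ ℝ ℝ))
    ((hθv.smul_const (ContinuousLinearMap.fst ℝ ℝ ℝ)).add
      (hθu.smul_const (ContinuousLinearMap.snd ℝ ℝ ℝ)))
    (hl.smul_const (ContinuousLinearMap.fst ℝ ℝ ℝ)) (hl.smul_const (ContinuousLinearMap.snd ℝ ℝ ℝ))
  have eφ := H.hypLaplace_φ p hp
  have eθ := H.hypLaplace_θ p hp
  rw [hypLaplace] at eφ eθ
  have cφ := dv_du_eq_du_dv hD H.smooth_φ hp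
  have cθ := dv_du_eq_du_dv hD H.smooth_θ hp
  unfold motionConnection at hd ⊢
  refine connectionOp_flat (m := motionForms φ θ α β lam) (m' := frameMatrix _ _ _ _ _ _ _ _) hm hd h k (fun i l => ?_) w
  refine frameMatrix_flat ?_ ?_ ?_ ?_ ?_ ?_ ?_ ?_ ?_ ?_ i l
  all_goals
    simp only [neg_apply, add_apply, smul_apply, ContinuousLinearMap.smulRight_apply,
      ContinuousLinearMap.coe_fst', ContinuousLinearMap.coe_snd', smul_eq_mul,
      H.fderiv_α p hp, H.fderiv_β p hp, H.fderiv_lam p hp, fderiv_apply_eq_du_dv (du φ),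
      fderiv_apply_eq_du_dv (dv φ), fderiv_apply_eq_du_dv (du θ), fderiv_apply_eq_du_dv (dv θ),
      fderiv_apply_eq_du_dv φ, fderiv_apply_eq_du_dv θ, cφ, cθ]
  -- The Gauss equation, multiplied by the area form evaluated on `h, k`.
  · linear_combination (h.2 * k.1 - h.1 * k.2) * eφ
  · ring
  · ring
  · ring
  · ring
  -- The Ricci equation.
  · linear_combination (h.1 * k.2 - h.2 * k.1) * eθ
  all_goals ring

/-- The equations of motion of the frame of a surface in canonical parameters. -/
structure IsMovingFrame (D : Set (ℝ × ℝ)) (φ θ α β lam : ℝ × ℝ → ℝ)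
    (x y n₁ n₂ z : ℝ × ℝ → R41) : Prop where
  smooth_x : ContDiffOn ℝ ∞ x D
  smooth_y : ContDiffOn ℝ ∞ y D
  smooth_n₁ : ContDiffOn ℝ ∞ n₁ D
  smooth_n₂ : ContDiffOn ℝ ∞ n₂ D
  smooth_z : ContDiffOn ℝ ∞ z D
  du_x : ∀ p ∈ D, du x p = -dv φ p • y p + α p • n₁ p
  dv_x : ∀ p ∈ D, dv x p = -du φ p • y p + β p • n₂ p
  du_y : ∀ p ∈ D, du y p = -dv φ p • x p + β p • n₂ p
  dv_y : ∀ p ∈ D, dv y p = -du φ p • x p + α p • n₁ p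
  du_n₁ : ∀ p ∈ D, du n₁ p = α p • x p + dv θ p • n₂ p
  dv_n₁ : ∀ p ∈ D, dv n₁ p = -α p • y p + du θ p • n₂ p
  du_n₂ : ∀ p ∈ D, du n₂ p = -β p • y p - dv θ p • n₁ p
  dv_n₂ : ∀ p ∈ D, dv n₂ p = β p • x p - du θ p • n₁ p
  du_z : ∀ p ∈ D, du z p = lam p • x p
  dv_z : ∀ p ∈ D, dv z p = lam p • y p

theorem IsMovingFrame.mono {D' : Set (ℝ × ℝ)} {x y n₁ n₂ z : ℝ × ℝ → R41}
    (H : IsMovingFrame D φ θ α β lam x y n₁ n₂ z) (h : D' ⊆ D) :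
    IsMovingFrame D' φ θ α β lam x y n₁ n₂ z where
  smooth_x := H.smooth_x.mono h
  smooth_y := H.smooth_y.mono h
  smooth_n₁ := H.smooth_n₁.mono h
  smooth_n₂ := H.smooth_n₂.mono h
  smooth_z := H.smooth_z.mono h
  du_x p hp := H.du_x p (h hp)
  dv_x p hp := H.dv_x p (h hp)
  du_y p hp := H.du_y p (h hp)
  dv_y p hp := H.dv_y p (h hp)
  du_n₁ p hp := H.du_n₁ p (h hp)
  dv_n₁ p hp := H.dv_n₁ p (h hp)
  du_n₂ p hp := H.du_n₂ p (h hp)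
  dv_n₂ p hp := H.dv_n₂ p (h hp)
  du_z p hp := H.du_z p (h hp)
  dv_z p hp := H.dv_z p (h hp)

theorem IsMovingFrame.hasFDerivAt (hD : IsOpen D) {x y n₁ n₂ z : ℝ × ℝ → R41}
    (H : IsMovingFrame D φ θ α β lam x y n₁ n₂ z) {p : ℝ × ℝ} (hp : p ∈ D) :
    HasFDerivAt (fun p => ![x p, y p, n₁ p, n₂ p, z p])
      ((motionConnection φ θ α β lam p).flip ![x p, y p, n₁ p, n₂ p, z p]) p := by
  have key : ∀ f : ℝ × ℝ → R41, ContDiffOn ℝ ∞ f D → ∀ i, (∀ h : ℝ × ℝ, h.1 • du f p + h.2 • dv f p =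
      motionConnection φ θ α β lam p h ![x p, y p, n₁ p, n₂ p, z p] i) →
      HasFDerivAt f ((ContinuousLinearMap.proj i).comp
        ((motionConnection φ θ α β lam p).flip ![x p, y p, n₁ p, n₂ p, z p])) p := by
    intro f hf i hi
    refine (differentiableAt_of_smooth hD hf hp).hasFDerivAt.congr_fderiv ?_
    refine ContinuousLinearMap.ext fun h => ?_
    rw [fderiv_apply_eq_du_dv, hi]
    rfl
  refine hasFDerivAt_pi'.2 fun i => ?_
  fin_cases i
  · refine key x H.smooth_x 0 fun h => ?_
    rw [H.du_x p hp, H.dv_x p hp, motionConnection, connectionOp_apply]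
    simp [motionForms, frameMatrix, Fin.sum_univ_five]
    module
  · refine key y H.smooth_y 1 fun h => ?_
    rw [H.du_y p hp, H.dv_y p hp, motionConnection, connectionOp_apply]
    simp [motionForms, frameMatrix, Fin.sum_univ_five]
    module
  · refine key n₁ H.smooth_n₁ 2 fun h => ?_
    rw [H.du_n₁ p hp, H.dv_n₁ p hp, motionConnection, connectionOp_apply]
    simp [motionForms, frameMatrix, Fin.sum_univ_five]
    module
  · refine key n₂ H.smooth_n₂ 3 fun h => ?_
    rw [H.du_n₂ p hp, H.dv_n₂ p hp, motionConnection, connectionOp_apply]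
    simp [motionForms, frameMatrix, Fin.sum_univ_five]
    module
  · refine key z H.smooth_z 4 fun h => ?_
    rw [H.du_z p hp, H.dv_z p hp, motionConnection, connectionOp_apply]
    simp [motionForms, frameMatrix, Fin.sum_univ_five]
    module

theorem IsMovingFrame.eqOn (hD : IsOpen D) (hc : IsPreconnected D)
    (H : IsMotionData D φ θ α β lam) {x y n₁ n₂ z x' y' n₁' n₂' z' : ℝ × ℝ → R41}
    (h : IsMovingFrame D φ θ α β lam x y n₁ n₂ z)
    (h' : IsMovingFrame D φ θ α β lam x' y' n₁' n₂' z') {q₀ : ℝ × ℝ} (hq₀ : q₀ ∈ D)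
    (hx : x q₀ = x' q₀) (hy : y q₀ = y' q₀) (hn₁ : n₁ q₀ = n₁' q₀) (hn₂ : n₂ q₀ = n₂' q₀)
    (hz : z q₀ = z' q₀) : EqOn z z' D := fun p hp => by
  have := eqOn_of_linear_system hD hc (contDiffOn_motionConnection hD H).continuousOn
    (fun p hp => h.hasFDerivAt hD hp) (fun p hp => h'.hasFDerivAt hD hp) hq₀
    (by simp only [hx, hy, hn₁, hn₂, hz]) hp
  exact congrFun this 4

/-- The position vector is the fifth unknown, so the surface is produced along with its frame and no
closed one-form has to be integrated afterwards. -/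
theorem exists_isMovingFrame (hD : IsOpen D) (H : IsMotionData D φ θ α β lam) {q₀ : ℝ × ℝ}
    (hq₀ : q₀ ∈ D) (x₀ y₀ n₁₀ n₂₀ p₀ : R41) :
    ∃ r > 0, ball q₀ r ⊆ D ∧ ∃ x y n₁ n₂ z : ℝ × ℝ → R41,
      IsMovingFrame (ball q₀ r) φ θ α β lam x y n₁ n₂ z ∧
      x q₀ = x₀ ∧ y q₀ = y₀ ∧ n₁ q₀ = n₁₀ ∧ n₂ q₀ = n₂₀ ∧ z q₀ = p₀ := by
  have hΩ := contDiffOn_motionConnection hD H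
  obtain ⟨r, hr, hsub, W, hW₀, hW⟩ := exists_solution_linear_system hD
    (hΩ.of_le (WithTop.coe_le_coe.2 (le_top (a := (2 : ℕ∞))))) hq₀
    (fun p hp => motionConnection_flat hD H hp) ![x₀, y₀, n₁₀, n₂₀, p₀]
  have hs := contDiffOn_pi.1 (contDiffOn_of_linear_system isOpen_ball (hΩ.mono hsub) hW)
  have key : ∀ p ∈ ball q₀ r, ∀ i h, fderiv ℝ (fun q => W q i) p h =
      ∑ j, motionForms φ θ α β lam p i j h • W p j := fun p hp i h => by
    rw [(hasFDerivAt_pi'.1 (hW p hp) i).fderiv, ← connectionOp_apply]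
    rfl
  refine ⟨r, hr, hsub, fun p => W p 0, fun p => W p 1, fun p => W p 2, fun p => W p 3,
    fun p => W p 4, ⟨hs 0, hs 1, hs 2, hs 3, hs 4, ?_, ?_, ?_, ?_, ?_, ?_, ?_, ?_, ?_, ?_⟩,
    by simp [hW₀], by simp [hW₀], by simp [hW₀], by simp [hW₀], by simp [hW₀]⟩
  all_goals
    intro p hp
    simp only [du, dv, key p hp]
    simp [motionForms, frameMatrix, Fin.sum_univ_five, du, dv]
    try module

end

/-! ### The Minkowski product and the constancy of Gram matrices. -/

section Minkowski

theorem mink_comm (a b : R41) : mink a b = mink b a := by unfold mink; ring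

theorem mink_add_left (a b c : R41) : mink (a + b) c = mink a c + mink b c := by
  simp only [mink, Pi.add_apply]; ring

theorem mink_smul_left (t : ℝ) (a b : R41) : mink (t • a) b = t * mink a b := by
  simp only [mink, Pi.smul_apply, smul_eq_mul]; ring

theorem mink_smul_right (t : ℝ) (a b : R41) : mink a (t • b) = t * mink a b := by
  simp only [mink, Pi.smul_apply, smul_eq_mul]; ring

theorem mink_sub_left (a b c : R41) : mink (a - b) c = mink a c - mink b c := by
  simp only [mink, Pi.sub_apply]; ring

theorem mink_sum_left {ι : Type*} (s : Finset ι) (f : ι → R41) (b : R41) :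
    mink (∑ i ∈ s, f i) b = ∑ i ∈ s, mink (f i) b := by
  simp only [mink, Finset.sum_apply, Finset.sum_mul, Finset.sum_add_distrib,
    Finset.sum_sub_distrib]

theorem exists_hasFDerivAt_mink {f g : ℝ × ℝ → R41} {f' g' : ℝ × ℝ →L[ℝ] R41} {p : ℝ × ℝ}
    (hf : HasFDerivAt f f' p) (hg : HasFDerivAt g g' p) :
    ∃ L : ℝ × ℝ →L[ℝ] ℝ, HasFDerivAt (fun q => mink (f q) (g q)) L p ∧
      ∀ h, L h = mink (f' h) (g p) + mink (f p) (g' h) := by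
  have hf' := hasFDerivAt_pi'.1 hf
  have hg' := hasFDerivAt_pi'.1 hg
  refine ⟨_, ((((hf' 0).mul (hg' 0)).add ((hf' 1).mul (hg' 1))).add ((hf' 2).mul (hg' 2))).sub
    ((hf' 3).mul (hg' 3)), fun h => ?_⟩
  simp [mink]
  ring

theorem fderiv_mink {f g : ℝ × ℝ → R41} {p : ℝ × ℝ} (hf : DifferentiableAt ℝ f p)
    (hg : DifferentiableAt ℝ g p) (h : ℝ × ℝ) :
    fderiv ℝ (fun q => mink (f q) (g q)) p h =
      mink (fderiv ℝ f p h) (g p) + mink (f p) (fderiv ℝ g p h) := by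
  obtain ⟨L, hL, hL'⟩ := exists_hasFDerivAt_mink hf.hasFDerivAt hg.hasFDerivAt
  rw [hL.fderiv, hL']

/-- The Gram matrix of vector fields moving with an infinitesimally isometric connection matrix
is constant. -/
theorem mink_eq_of_skew_connection {ι : Type*} [Fintype ι] [DecidableEq ι] {D : Set (ℝ × ℝ)}
    (hD : IsOpen D) (hc : IsPreconnected D) {m : ℝ × ℝ → ι → ι → ℝ × ℝ →L[ℝ] ℝ}
    (hm : ∀ i j, ContDiffOn ℝ ∞ (fun p => m p i j) D) {w : ι → ℝ × ℝ → R41}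
    (hd : ∀ p ∈ D, ∀ i, DifferentiableAt ℝ (w i) p)
    (hw : ∀ p ∈ D, ∀ i h, fderiv ℝ (w i) p h = ∑ j, m p i j h • w j p) {η : ι → ι → ℝ}
    (hη : ∀ p ∈ D, ∀ i j h, ∑ k, m p i k h * η k j + ∑ k, m p j k h * η i k = 0)
    {q₀ : ℝ × ℝ} (hq₀ : q₀ ∈ D) (h0 : ∀ i j, mink (w i q₀) (w j q₀) = η i j) :
    ∀ p ∈ D, ∀ i j, mink (w i p) (w j p) = η i j := by
  -- By the product rule the Gram entries `X (i, j)` satisfy `dX (i, j) = ∑ m i k X (k, j) + ∑ m j k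
  -- X (i, k)`, itself a linear system; `M` is its matrix.
  set M : ℝ × ℝ → ι × ι → ι × ι → ℝ × ℝ →L[ℝ] ℝ := fun p s t =>
    (if s.2 = t.2 then m p s.1 t.1 else 0) + (if s.1 = t.1 then m p s.2 t.2 else 0) with hM
  have hMs : ∀ s t, ContDiffOn ℝ ∞ (fun p => M p s t) D := fun s t => by
    refine ContDiffOn.add ?_ ?_
    · split_ifs
      exacts [hm _ _, contDiffOn_const]
    · split_ifs
      exacts [hm _ _, contDiffOn_const]
  have hMsum : ∀ p (X : ι × ι → ℝ) (s : ι × ι) h, ∑ t, M p s t h • X t =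
      ∑ k, m p s.1 k h * X (k, s.2) + ∑ k, m p s.2 k h * X (s.1, k) := fun p X s h => by
    rw [Fintype.sum_prod_type]
    simp only [hM, add_apply, smul_eq_mul, add_mul, Finset.sum_add_distrib]
    congr 1
    · refine Finset.sum_congr rfl fun k _ => ?_
      rw [Finset.sum_eq_single s.2 (fun b _ hb => by simp [hb.symm]) (by simp)]
      simp
    · rw [Finset.sum_comm]
      refine Finset.sum_congr rfl fun k _ => ?_
      rw [Finset.sum_eq_single s.1 (fun b _ hb => by simp [hb.symm]) (by simp)]
      simp
  have h1 : ∀ p ∈ D, HasFDerivAt (fun q (s : ι × ι) => mink (w s.1 q) (w s.2 q))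
      ((connectionOp (G := ℝ) (M p)).flip fun s => mink (w s.1 p) (w s.2 p)) p := fun p hp => by
    refine hasFDerivAt_pi'.2 fun s => ?_
    obtain ⟨L, hL, hL'⟩ := exists_hasFDerivAt_mink (hd p hp s.1).hasFDerivAt
      (hd p hp s.2).hasFDerivAt
    refine hL.congr_fderiv (ContinuousLinearMap.ext fun h => ?_)
    rw [hL', hw p hp, hw p hp, mink_comm (w s.1 p), mink_sum_left, mink_sum_left]
    change _ = connectionOp (G := ℝ) (M p) h (fun s => mink (w s.1 p) (w s.2 p)) s
    rw [connectionOp_apply, hMsum]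
    simp only [mink_smul_left]
    simp only [mink_comm]
  -- The constant matrix `η` solves the same system, because skewness makes the right side vanish.
  have h2 : ∀ p ∈ D, HasFDerivAt (fun (_ : ℝ × ℝ) (s : ι × ι) => η s.1 s.2)
      ((connectionOp (G := ℝ) (M p)).flip fun s => η s.1 s.2) p := fun p hp => by
    refine (hasFDerivAt_const _ _).congr_fderiv (ContinuousLinearMap.ext fun h => ?_)
    ext1 s
    change 0 = connectionOp (G := ℝ) (M p) h (fun s => η s.1 s.2) s
    rw [connectionOp_apply, hMsum, hη p hp]
  have := eqOn_of_linear_system hD hc (contDiffOn_connectionOp hMs).continuousOn h1 h2 hq₀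
    (funext fun s => h0 s.1 s.2)
  exact fun p hp i j => congrFun (this hp) (i, j)

end Minkowski

/-! ### Orthonormality propagates along a moving frame. -/

section

variable {D : Set (ℝ × ℝ)} {φ θ α β lam : ℝ × ℝ → ℝ} {x y n₁ n₂ z : ℝ × ℝ → R41}

theorem IsMovingFrame.isOrthonormalFrame (hD : IsOpen D) (hc : IsPreconnected D)
    (H : IsMotionData D φ θ α β lam) (F : IsMovingFrame D φ θ α β lam x y n₁ n₂ z)
    {q₀ : ℝ × ℝ} (hq₀ : q₀ ∈ D) (h0 : IsOrthonormalFrame (x q₀) (y q₀) (n₁ q₀) (n₂ q₀)) :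
    ∀ p ∈ D, IsOrthonormalFrame (x p) (y p) (n₁ p) (n₂ p) := by
  -- The frame vectors never involve `z`, so the upper left four by four block is a closed
  -- subsystem.
  have hm : ∀ i j : Fin 4, ContDiffOn ℝ ∞
      (fun p => motionForms φ θ α β lam p i.castSucc j.castSucc) D := fun i j => by
    have hφu := contDiffOn_du hD H.smooth_φ
    have hφv := contDiffOn_dv hD H.smooth_φ
    have hθu := contDiffOn_du hD H.smooth_θ
    have hθv := contDiffOn_dv hD H.smooth_θ
    have hα := H.smooth_α
    have hβ := H.smooth_β
    have hl := H.smooth_lam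
    exact contDiffOn_frameMatrix (by fun_prop) (by fun_prop) (by fun_prop)
      (by fun_prop) (by fun_prop) (by fun_prop) (by fun_prop) (by fun_prop) _ _
  have hd : ∀ p ∈ D, ∀ i, DifferentiableAt ℝ ((![x, y, n₁, n₂] : Fin 4 → ℝ × ℝ → R41) i) p := by
    intro p hp i
    fin_cases i
    exacts [differentiableAt_of_smooth hD F.smooth_x hp,
      differentiableAt_of_smooth hD F.smooth_y hp, differentiableAt_of_smooth hD F.smooth_n₁ hp,
      differentiableAt_of_smooth hD F.smooth_n₂ hp]
  have key := mink_eq_of_skew_connection hD hc hm (w := ![x, y, n₁, n₂]) hd (fun p hp i h => by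
      rw [fderiv_apply_eq_du_dv]
      fin_cases i <;>
        simp [motionForms, frameMatrix, Fin.sum_univ_four, F.du_x p hp, F.dv_x p hp, F.du_y p hp,
          F.dv_y p hp, F.du_n₁ p hp, F.dv_n₁ p hp, F.du_n₂ p hp, F.dv_n₂ p hp] <;> module)
    (η := ![![-1, 0, 0, 0], ![0, 1, 0, 0], ![0, 0, 1, 0], ![0, 0, 0, 1]])
    (fun p hp i j h => by
      fin_cases i <;> fin_cases j <;> simp [motionForms, frameMatrix, Fin.sum_univ_four])
    hq₀ (fun i j => by
      fin_cases i <;> fin_cases j <;>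
        simp [h0.xx, h0.yy, h0.n₁n₁, h0.n₂n₂, h0.xy, h0.xn₁, h0.xn₂, h0.yn₁, h0.yn₂, h0.n₁n₂,
          mink_comm (y q₀) (x q₀), mink_comm (n₁ q₀) (x q₀), mink_comm (n₂ q₀) (x q₀),
          mink_comm (n₁ q₀) (y q₀), mink_comm (n₂ q₀) (y q₀), mink_comm (n₂ q₀) (n₁ q₀)])
  exact fun p hp => ⟨key p hp 0 0, key p hp 1 1, key p hp 2 2, key p hp 3 3, key p hp 0 1,
    key p hp 0 2, key p hp 0 3, key p hp 1 2, key p hp 1 3, key p hp 2 3⟩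

end

/-! ### The normal projection and the second fundamental tensor in coordinates. -/

section

variable {D : Set (ℝ × ℝ)} {z : ℝ × ℝ → R41} {p : ℝ × ℝ}

theorem normalPart_add (z : ℝ × ℝ → R41) (p : ℝ × ℝ) (v w : R41) :
    normalPart z p (v + w) = normalPart z p v + normalPart z p w := by
  simp only [normalPart, mink_add_left]
  module

theorem normalPart_smul (z : ℝ × ℝ → R41) (p : ℝ × ℝ) (t : ℝ) (v : R41) :
    normalPart z p (t • v) = t • normalPart z p v := by
  simp only [normalPart, mink_smul_left]
  module

theorem sigma_eq (hD : IsOpen D) (hz : ContDiffOn ℝ ∞ z D) (hp : p ∈ D) (a b : ℝ × ℝ) :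
    sigma z p a b = (a.1 * b.1) • normalPart z p (du (du z) p)
      + (a.1 * b.2 + a.2 * b.1) • normalPart z p (du (dv z) p)
      + (a.2 * b.2) • normalPart z p (dv (dv z) p) := by
  have hfun : (fun q => fderiv ℝ z q b) = fun q => b.1 • du z q + b.2 • dv z q :=
    funext fun q => fderiv_apply_eq_du_dv z q b
  have hu := differentiableAt_of_smooth hD (contDiffOn_du hD hz) hp
  have hv := differentiableAt_of_smooth hD (contDiffOn_dv hD hz) hp
  have h1 : fderiv ℝ (fun q => b.1 • du z q + b.2 • dv z q) p a =
      b.1 • fderiv ℝ (du z) p a + b.2 • fderiv ℝ (dv z) p a := by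
    have : HasFDerivAt (fun q => b.1 • du z q + b.2 • dv z q)
        (b.1 • fderiv ℝ (du z) p + b.2 • fderiv ℝ (dv z) p) p :=
      (hu.hasFDerivAt.const_smul b.1).add (hv.hasFDerivAt.const_smul b.2)
    rw [this.fderiv]
    simp
  rw [sigma, hfun, h1, fderiv_apply_eq_du_dv (du z), fderiv_apply_eq_du_dv (dv z),
    dv_du_eq_du_dv hD hz hp]
  simp only [normalPart_add, normalPart_smul]
  module

theorem normalPart_of_frame {x y n₁ n₂ : R41} {l : ℝ} (hl : l ≠ 0)
    (h : IsOrthonormalFrame x y n₁ n₂) (hu : du z p = l • x) (hv : dv z p = l • y)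
    (a b c d : ℝ) :
    normalPart z p (a • x + b • y + c • n₁ + d • n₂) = c • n₁ + d • n₂ := by
  have e1 : mink (a • x + b • y + c • n₁ + d • n₂) (l • x) = -(a * l) := by
    simp only [mink_add_left, mink_smul_left, mink_smul_right, h.xx, mink_comm y x,
      mink_comm n₁ x, mink_comm n₂ x, h.xy, h.xn₁, h.xn₂]
    ring
  have e2 : mink (a • x + b • y + c • n₁ + d • n₂) (l • y) = b * l := by
    simp only [mink_add_left, mink_smul_left, mink_smul_right, h.yy,
      mink_comm n₁ y, mink_comm n₂ y, h.xy, h.yn₁, h.yn₂]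
    ring
  have eE : coeffE z p = -(l * l) := by
    rw [coeffE, hu, mink_smul_left, mink_smul_right, h.xx]; ring
  have eF : coeffF z p = 0 := by
    rw [coeffF, hu, hv, mink_smul_left, mink_smul_right, h.xy]; ring
  have eG : coeffG z p = l * l := by
    rw [coeffG, hv, mink_smul_left, mink_smul_right, h.yy]; ring
  have c1 : (l * l * -(a * l) - 0 * (b * l)) / (-(l * l) * (l * l) - 0 ^ 2) * l = a := by
    field_simp; ring
  have c2 : (-(l * l) * (b * l) - 0 * -(a * l)) / (-(l * l) * (l * l) - 0 ^ 2) * l = b := by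
    field_simp; ring
  rw [normalPart, gramDet, eE, eF, eG, hu, hv, e1, e2, smul_smul, smul_smul, c1, c2]
  module

theorem mink_normalPart {n : R41} (hu : mink (du z p) n = 0) (hv : mink (dv z p) n = 0) (w : R41) :
    mink (normalPart z p w) n = mink w n := by
  simp [normalPart, mink_sub_left, mink_smul_left, hu, hv]

theorem fderiv_smul_of_eqOn {f : ℝ × ℝ → R41} {lam : ℝ × ℝ → ℝ} {x : ℝ × ℝ → R41} (hD : IsOpen D)
    (hlam : ContDiffOn ℝ ∞ lam D) (hx : ContDiffOn ℝ ∞ x D) (hf : ∀ q ∈ D, f q = lam q • x q)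
    (hp : p ∈ D) (h : ℝ × ℝ) :
    fderiv ℝ f p h = lam p • fderiv ℝ x p h + fderiv ℝ lam p h • x p := by
  have he : f =ᶠ[𝓝 p] fun q => lam q • x q := Filter.eventually_of_mem (hD.mem_nhds hp) hf
  rw [he.fderiv_eq, fderiv_fun_smul (differentiableAt_of_smooth hD hlam hp)
    (differentiableAt_of_smooth hD hx hp)]
  simp

end

theorem IsOrthonormalFrame.linearIndependent_normal {x y n₁ n₂ : R41}
    (h : IsOrthonormalFrame x y n₁ n₂) {a b : ℝ} (ha : a ≠ 0) (hb : b ≠ 0) :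
    LinearIndependent ℝ ![a • n₁, b • n₂] := by
  rw [LinearIndependent.pair_iff]
  intro s t hst
  have e1 : mink (s • a • n₁ + t • b • n₂) n₁ = s * a := by
    simp only [mink_add_left, mink_smul_left, h.n₁n₁, mink_comm n₂ n₁, h.n₁n₂]; ring
  have e2 : mink (s • a • n₁ + t • b • n₂) n₂ = t * b := by
    simp only [mink_add_left, mink_smul_left, h.n₂n₂, h.n₁n₂]; ring
  rw [hst] at e1 e2
  simp only [mink, Pi.zero_apply, zero_mul, add_zero, sub_zero] at e1 e2
  exact ⟨by simpa [ha] using e1.symm, by simpa [hb] using e2.symm⟩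

/-! ### From an orthonormal moving frame to the surface. -/

section

variable {D : Set (ℝ × ℝ)} {φ θ α β lam μ ν : ℝ × ℝ → ℝ} {x y n₁ n₂ z : ℝ × ℝ → R41}

/-- A moving frame that is orthonormal describes a surface of the required kind. -/
theorem IsMovingFrame.isSurfaceWithData (hD : IsOpen D)
    (H : IsMotionData D φ θ α β lam) (F : IsMovingFrame D φ θ α β lam x y n₁ n₂ z)
    (ho : ∀ p ∈ D, IsOrthonormalFrame (x p) (y p) (n₁ p) (n₂ p))
    (hα : ∀ p ∈ D, α p = lam p * ν p) (hβ : ∀ p ∈ D, β p = lam p * μ p)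
    (hlam : ∀ p ∈ D, lam p ^ 2 = 1 / √(μ p ^ 2 + ν p ^ 2)) (q₀ : ℝ × ℝ) :
    IsSurfaceWithData μ ν D q₀ (z q₀) (x q₀) (y q₀) (n₁ q₀) (n₂ q₀) z := by
  have hE : ∀ p ∈ D, coeffE z p = -lam p ^ 2 := fun p hp => by
    rw [coeffE, F.du_z p hp, mink_smul_left, mink_smul_right, (ho p hp).xx]; ring
  have hF : ∀ p ∈ D, coeffF z p = 0 := fun p hp => by
    rw [coeffF, F.du_z p hp, F.dv_z p hp, mink_smul_left, mink_smul_right, (ho p hp).xy]; ring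
  have hG : ∀ p ∈ D, coeffG z p = lam p ^ 2 := fun p hp => by
    rw [coeffG, F.dv_z p hp, mink_smul_left, mink_smul_right, (ho p hp).yy]; ring
  have huu : ∀ p ∈ D, normalPart z p (du (du z) p) = (lam p * α p) • n₁ p := fun p hp => by
    have h1 : du (du z) p = (du lam p) • x p + (lam p * -dv φ p) • y p + (lam p * α p) • n₁ p
        + (0 : ℝ) • n₂ p := by
      have := fderiv_smul_of_eqOn hD H.smooth_lam F.smooth_x F.du_z hp (1, 0)
      change du (du z) p = lam p • du x p + du lam p • x p at this
      rw [this, F.du_x p hp]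
      module
    rw [h1, normalPart_of_frame (H.lam_pos p hp).ne' (ho p hp) (F.du_z p hp) (F.dv_z p hp)]
    module
  have huv : ∀ p ∈ D, normalPart z p (du (dv z) p) = (lam p * β p) • n₂ p := fun p hp => by
    have h1 : du (dv z) p = (lam p * -dv φ p) • x p + (du lam p) • y p + (0 : ℝ) • n₁ p
        + (lam p * β p) • n₂ p := by
      have := fderiv_smul_of_eqOn hD H.smooth_lam F.smooth_y F.dv_z hp (1, 0)
      change du (dv z) p = lam p • du y p + du lam p • y p at this
      rw [this, F.du_y p hp]
      module
    rw [h1, normalPart_of_frame (H.lam_pos p hp).ne' (ho p hp) (F.du_z p hp) (F.dv_z p hp)]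
    module
  have hvv : ∀ p ∈ D, normalPart z p (dv (dv z) p) = (lam p * α p) • n₁ p := fun p hp => by
    have h1 : dv (dv z) p = (lam p * -du φ p) • x p + (dv lam p) • y p + (lam p * α p) • n₁ p
        + (0 : ℝ) • n₂ p := by
      have := fderiv_smul_of_eqOn hD H.smooth_lam F.smooth_y F.dv_z hp (0, 1)
      change dv (dv z) p = lam p • dv y p + dv lam p • y p at this
      rw [this, F.dv_y p hp]
      module
    rw [h1, normalPart_of_frame (H.lam_pos p hp).ne' (ho p hp) (F.du_z p hp) (F.dv_z p hp)]
    module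
  have hσ : ∀ p ∈ D, ∀ a b, sigma z p a b = (lam p * α p * (a.1 * b.1 + a.2 * b.2)) • n₁ p
      + (lam p * β p * (a.1 * b.2 + a.2 * b.1)) • n₂ p := fun p hp a b => by
    rw [sigma_eq hD F.smooth_z hp, huu p hp, huv p hp, hvv p hp]
    module
  have hgram : ∀ p ∈ D, gramDet z p < 0 := fun p hp => by
    have := H.lam_pos p hp
    have h4 : 0 < lam p ^ 2 * lam p ^ 2 := by positivity
    rw [gramDet, hE p hp, hF p hp, hG p hp]
    linarith
  refine ⟨⟨F.smooth_z, hgram⟩, fun p hp => ?_, fun p hp hflat => ?_, rfl,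
    x, y, n₁, n₂, ⟨F.smooth_x, F.smooth_y, F.smooth_n₁, F.smooth_n₂, fun p hp => ⟨ho p hp, ?_⟩⟩,
    ⟨rfl, rfl, rfl, rfl⟩, ⟨fun p hp => ?_, fun p hp => ?_, fun p hp => ?_, hF, fun p hp => ?_⟩⟩
  -- Here `E = -G`, `F = 0` and `σ` agrees on the two coordinate directions, so the trace cancels.
  · rw [meanCurvature, hσ p hp, hσ p hp, hσ p hp, hE p hp, hF p hp, hG p hp]
    simp
  · have hl := (H.lam_pos p hp).ne'
    have hli := (ho p hp).linearIndependent_normal (mul_ne_zero hl (H.α_ne p hp))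
      (mul_ne_zero hl (H.β_ne p hp))
    have hcard := finrank_span_eq_card hli
    -- The values `σ(∂u, ∂u)` and `σ(∂u, ∂v)` are nonzero multiples of `n₁` and `n₂`, so the span
    -- has dimension at least two.
    have hle : Submodule.span ℝ (range ![(lam p * α p) • n₁ p, (lam p * β p) • n₂ p]) ≤
        Submodule.span ℝ (range fun ab : (ℝ × ℝ) × (ℝ × ℝ) => sigma z p ab.1 ab.2) := by
      refine Submodule.span_mono ?_
      rintro _ ⟨i, rfl⟩
      fin_cases i
      · exact ⟨((1, 0), (1, 0)), by simp [hσ p hp]⟩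
      · exact ⟨((1, 0), (0, 1)), by simp [hσ p hp]⟩
    have := Submodule.finrank_mono hle
    rw [hcard, Fintype.card_fin] at this
    have hflat' : Module.finrank ℝ _ ≤ 1 := hflat
    omega
  · have hl := (H.lam_pos p hp).ne'
    refine ⟨((lam p)⁻¹, 0), (0, (lam p)⁻¹), ?_, ?_, ?_, ?_, ?_⟩
    · rw [fderiv_apply_eq_du_dv, F.du_z p hp]
      simp [smul_smul, hl]
    · rw [fderiv_apply_eq_du_dv, F.dv_z p hp]
      simp [smul_smul, hl]
    · rw [hσ p hp, hα p hp]
      simp only [mul_zero, add_zero, zero_mul, zero_smul]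
      congr 1
      field_simp
    · rw [hσ p hp, hβ p hp]
      simp only [mul_zero, add_zero, zero_mul, zero_smul, zero_add]
      congr 1
      field_simp
    · rw [hσ p hp, hα p hp]
      simp only [mul_zero, add_zero, zero_mul, zero_smul, zero_add]
      congr 1
      field_simp
  · rw [hE p hp, neg_neg, Real.sqrt_sq (H.lam_pos p hp).le, F.du_z p hp]
  · rw [hG p hp, Real.sqrt_sq (H.lam_pos p hp).le, F.dv_z p hp]
  · rw [hE p hp, hlam p hp]
  · rw [hG p hp, hlam p hp]

end

/-- The expansion of a vector in an orthonormal frame of Minkowski space. -/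
theorem IsOrthonormalFrame.expand {x y n₁ n₂ : R41} (h : IsOrthonormalFrame x y n₁ n₂) (w : R41) :
    w = (-mink w x) • x + mink w y • y + mink w n₁ • n₁ + mink w n₂ • n₂ := by
  set F : Fin 4 → R41 := ![x, y, n₁, n₂] with hF
  set A : Matrix (Fin 4) (Fin 4) ℝ := Matrix.of F with hA
  set J : Fin 4 → ℝ := ![1, 1, 1, -1] with hJ
  set η : Fin 4 → ℝ := ![-1, 1, 1, 1] with hη
  set B : Matrix (Fin 4) (Fin 4) ℝ := Matrix.of fun l i => J l * F i l * η i with hB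
  have h1 : ∀ i j, (A * B) i j = mink (F i) (F j) * η j := fun i j => by
    simp [Matrix.mul_apply, Fin.sum_univ_four, hA, hB, hJ, mink]
    ring
  have hAB : A * B = 1 := by
    ext i j
    rw [h1]
    fin_cases i <;> fin_cases j <;>
      simp [hF, hη, h.xx, h.yy, h.n₁n₁, h.n₂n₂, h.xy, h.xn₁, h.xn₂, h.yn₁, h.yn₂, h.n₁n₂,
        mink_comm y x, mink_comm n₁ x, mink_comm n₂ x, mink_comm n₁ y, mink_comm n₂ y,
        mink_comm n₂ n₁]
  -- Orthonormality says that `B` is a right inverse of the frame matrix `A`. For square matrices it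
  -- is then a left inverse, and `w B A = w` is the expansion.
  have hBA : B * A = 1 := mul_eq_one_comm.1 hAB
  have h2 : Matrix.vecMul w (B * A) = w := by rw [hBA, Matrix.vecMul_one]
  rw [← Matrix.vecMul_vecMul] at h2
  have h3 : ∀ i, Matrix.vecMul w B i = mink w (F i) * η i := fun i => by
    simp [Matrix.vecMul, dotProduct, Fin.sum_univ_four, hB, hJ, mink]
    ring
  ext k
  have h4 := congrFun h2 k
  simp only [Matrix.vecMul, dotProduct, Fin.sum_univ_four] at h4 h3
  rw [h3, h3, h3, h3] at h4
  rw [← h4]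
  simp [hA, hF, hη]

theorem mink_fderiv_add_eq_zero {D : Set (ℝ × ℝ)} (hD : IsOpen D) {f g : ℝ × ℝ → R41}
    (hf : ContDiffOn ℝ ∞ f D) (hg : ContDiffOn ℝ ∞ g D) {c : ℝ}
    (h : ∀ q ∈ D, mink (f q) (g q) = c) {p : ℝ × ℝ} (hp : p ∈ D) (k : ℝ × ℝ) :
    mink (fderiv ℝ f p k) (g p) + mink (fderiv ℝ g p k) (f p) = 0 := by
  have he : (fun q => mink (f q) (g q)) =ᶠ[𝓝 p] fun _ => c :=
    Filter.eventually_of_mem (hD.mem_nhds hp) h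
  have := fderiv_mink (differentiableAt_of_smooth hD hf hp) (differentiableAt_of_smooth hD hg hp) k
  rw [he.fderiv_eq] at this
  rw [mink_comm (fderiv ℝ g p k), ← this]
  simp

/-! ### From a surface in canonical parameters to the equations of motion. -/

section

variable {D : Set (ℝ × ℝ)} {φ θ α β lam μ ν : ℝ × ℝ → ℝ} {x y n₁ n₂ z : ℝ × ℝ → R41}

/-- The normal parts of the second derivatives of a surface in canonical parameters. -/
theorem normalPart_of_isGeometricFrameAt (hD : IsOpen D) (hz : ContDiffOn ℝ ∞ z D)
    {p : ℝ × ℝ} (hp : p ∈ D) {l m n : ℝ} (hl : l ≠ 0) {x y n₁ n₂ : R41}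
    (hu : du z p = l • x) (hv : dv z p = l • y)
    (h : IsGeometricFrameAt z p n m x y n₁ n₂) :
    normalPart z p (du (du z) p) = (l * (l * n)) • n₁ ∧
    normalPart z p (du (dv z) p) = (l * (l * m)) • n₂ ∧
    normalPart z p (dv (dv z) p) = (l * (l * n)) • n₁ := by
  obtain ⟨ho, a, b, ha, hb, haa, hab, hbb⟩ := h
  -- Pairing with `x` and `y` recovers parameter coordinates, which forces the vectors representing
  -- `x` and `y` to be `(1 / l, 0)` and `(0, 1 / l)`.
  have coord : ∀ (c : ℝ × ℝ) (v : R41), fderiv ℝ z p c = v →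
      c.1 * l = -mink v x ∧ c.2 * l = mink v y := fun c v hc => by
    rw [fderiv_apply_eq_du_dv, hu, hv] at hc
    rw [← hc]
    simp only [mink_add_left, mink_smul_left, ho.xx, ho.yy, ho.xy, mink_comm y x]
    constructor <;> ring
  obtain ⟨ha1, ha2⟩ := coord a x ha
  obtain ⟨hb1, hb2⟩ := coord b y hb
  rw [ho.xx, neg_neg] at ha1
  rw [ho.xy] at ha2
  rw [mink_comm, ho.xy, neg_zero] at hb1
  rw [ho.yy] at hb2
  have ha2' : a.2 = 0 := by simpa [hl] using ha2
  have hb1' : b.1 = 0 := by simpa [hl] using hb1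
  rw [sigma_eq hD hz hp] at haa hab hbb
  simp only [ha2', hb1', mul_zero, zero_mul, add_zero, zero_add, zero_smul] at haa hab hbb
  have e1 : (l * l) * (a.1 * a.1) = 1 := by linear_combination (a.1 * l + 1) * ha1
  have e2 : (l * l) * (a.1 * b.2) = 1 := by linear_combination (b.2 * l) * ha1 + hb2
  have e3 : (l * l) * (b.2 * b.2) = 1 := by linear_combination (b.2 * l + 1) * hb2
  refine ⟨?_, ?_, ?_⟩
  · rw [← mul_assoc, mul_smul, ← haa, smul_smul, e1, one_smul]
  · rw [← mul_assoc, mul_smul, ← hab, smul_smul, e2, one_smul]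
  · rw [← mul_assoc, mul_smul, ← hbb, smul_smul, e3, one_smul]

/-- A geometric frame field of a surface in canonical parameters satisfies the equations of
motion. -/
theorem isMovingFrame_of_isGeometricFrameField (hD : IsOpen D) (H : IsMotionData D φ θ α β lam)
    (hα : ∀ p ∈ D, α p = lam p * ν p) (hβ : ∀ p ∈ D, β p = lam p * μ p)
    (hlam : ∀ p ∈ D, lam p ^ 2 = 1 / √(μ p ^ 2 + ν p ^ 2)) (hz : ContDiffOn ℝ ∞ z D)
    (G : IsGeometricFrameField z D ν μ x y n₁ n₂) (C : AreCanonicalParameters z D ν μ x y) :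
    IsMovingFrame D φ θ α β lam x y n₁ n₂ z := by
  have hu : ∀ p ∈ D, du z p = lam p • x p := fun p hp => by
    rw [C.line_u p hp, C.E_eq p hp, neg_neg, ← hlam p hp, Real.sqrt_sq (H.lam_pos p hp).le]
  have hv : ∀ p ∈ D, dv z p = lam p • y p := fun p hp => by
    rw [C.line_v p hp, C.G_eq p hp, ← hlam p hp, Real.sqrt_sq (H.lam_pos p hp).le]
  have ho : ∀ p ∈ D, IsOrthonormalFrame (x p) (y p) (n₁ p) (n₂ p) := fun p hp => (G.frame p hp).1
  have sx := G.smooth_x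
  have sy := G.smooth_y
  have s1 := G.smooth_n₁
  have s2 := G.smooth_n₂
  have kxx := fun p hp k => mink_fderiv_add_eq_zero hD sx sx (fun q hq => (ho q hq).xx) (p := p) hp k
  have kyy := fun p hp k => mink_fderiv_add_eq_zero hD sy sy (fun q hq => (ho q hq).yy) (p := p) hp k
  have k11 := fun p hp k =>
    mink_fderiv_add_eq_zero hD s1 s1 (fun q hq => (ho q hq).n₁n₁) (p := p) hp k
  have k22 := fun p hp k =>
    mink_fderiv_add_eq_zero hD s2 s2 (fun q hq => (ho q hq).n₂n₂) (p := p) hp k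
  have kxy := fun p hp k => mink_fderiv_add_eq_zero hD sx sy (fun q hq => (ho q hq).xy) (p := p) hp k
  have kx1 := fun p hp k =>
    mink_fderiv_add_eq_zero hD sx s1 (fun q hq => (ho q hq).xn₁) (p := p) hp k
  have kx2 := fun p hp k =>
    mink_fderiv_add_eq_zero hD sx s2 (fun q hq => (ho q hq).xn₂) (p := p) hp k
  have ky1 := fun p hp k =>
    mink_fderiv_add_eq_zero hD sy s1 (fun q hq => (ho q hq).yn₁) (p := p) hp k
  have ky2 := fun p hp k =>
    mink_fderiv_add_eq_zero hD sy s2 (fun q hq => (ho q hq).yn₂) (p := p) hp k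
  have k12 := fun p hp k =>
    mink_fderiv_add_eq_zero hD s1 s2 (fun q hq => (ho q hq).n₁n₂) (p := p) hp k
  have hxy : ∀ p ∈ D, (mink (du x p) (y p) = -dv φ p ∧ mink (dv x p) (y p) = -du φ p) ∧
      (mink (du x p) (n₁ p) = α p ∧ mink (du x p) (n₂ p) = 0) ∧
      (mink (dv x p) (n₁ p) = 0 ∧ mink (dv x p) (n₂ p) = β p) ∧
      (mink (du y p) (n₁ p) = 0 ∧ mink (du y p) (n₂ p) = β p) ∧
      (mink (dv y p) (n₁ p) = α p ∧ mink (dv y p) (n₂ p) = 0) := by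
    intro p hp
    have o := ho p hp
    have hl := (H.lam_pos p hp).ne'
    obtain ⟨Nuu, Nuv, Nvv⟩ := normalPart_of_isGeometricFrameAt hD hz hp hl (hu p hp) (hv p hp)
      (G.frame p hp)
    rw [← hα p hp] at Nuu Nvv
    rw [← hβ p hp] at Nuv
    have zuu : du (du z) p = lam p • du x p + du lam p • x p :=
      fderiv_smul_of_eqOn hD H.smooth_lam sx hu hp (1, 0)
    have zuv : dv (du z) p = lam p • dv x p + dv lam p • x p :=
      fderiv_smul_of_eqOn hD H.smooth_lam sx hu hp (0, 1)
    have zvu : du (dv z) p = lam p • du y p + du lam p • y p :=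
      fderiv_smul_of_eqOn hD H.smooth_lam sy hv hp (1, 0)
    have zvv : dv (dv z) p = lam p • dv y p + dv lam p • y p :=
      fderiv_smul_of_eqOn hD H.smooth_lam sy hv hp (0, 1)
    have hcomm := dv_du_eq_du_dv hD hz hp
    have lu : du lam p = -(lam p * du φ p) := H.fderiv_lam p hp (1, 0)
    have lv : dv lam p = -(lam p * dv φ p) := H.fderiv_lam p hp (0, 1)
    have nrm : ∀ n, mink (x p) n = 0 → mink (y p) n = 0 → ∀ w,
        mink (normalPart z p w) n = mink w n := fun n h1 h2 w =>
      mink_normalPart (by rw [hu p hp, mink_smul_left, h1, mul_zero])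
        (by rw [hv p hp, mink_smul_left, h2, mul_zero]) w
    have m1 := nrm (n₁ p) o.xn₁ o.yn₁
    have m2 := nrm (n₂ p) o.xn₂ o.yn₂
    have cancel : ∀ {a b : ℝ}, lam p * a = lam p * b → a = b := fun h => mul_left_cancel₀ hl h
    have o21 : mink (n₂ p) (n₁ p) = 0 := by rw [mink_comm, o.n₁n₂]
    have oyx : mink (y p) (x p) = 0 := by rw [mink_comm, o.xy]
    have uu1 := m1 (du (du z) p)
    have uu2 := m2 (du (du z) p)
    have uv1 := m1 (du (dv z) p)
    have uv2 := m2 (du (dv z) p)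
    have vv1 := m1 (dv (dv z) p)
    have vv2 := m2 (dv (dv z) p)
    rw [Nuu, zuu] at uu1 uu2
    rw [Nuv] at uv1 uv2
    rw [Nvv, zvv] at vv1 vv2
    -- The normal part of the mixed derivative is read twice: from `(z_v)_u` it gives the normal
    -- components of `y_u`, from `(z_u)_v` those of `x_v`.
    have vu1 := uv1
    have vu2 := uv2
    rw [zvu] at uv1 uv2
    rw [← hcomm, zuv] at vu1 vu2
    rw [zuv, zvu] at hcomm
    -- The tangential components of `z_uv = z_vu`, with `dλ = -λ dφ`, determine the Levi-Civita
    -- coefficients `⟨x_u, y⟩ = -φ_v` and `⟨x_v, y⟩ = -φ_u`.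
    have sxx := congrArg (mink · (x p)) hcomm
    have syy := congrArg (mink · (y p)) hcomm
    have xv := kxx p hp (0, 1)
    have yu := kyy p hp (1, 0)
    have xyu := kxy p hp (1, 0)
    change mink (dv x p) (x p) + mink (dv x p) (x p) = 0 at xv
    change mink (du y p) (y p) + mink (du y p) (y p) = 0 at yu
    change mink (du x p) (y p) + mink (du y p) (x p) = 0 at xyu
    simp only [mink_add_left, mink_smul_left, o.xx, o.yy, o.n₁n₁, o.n₂n₂, o.xy, o.xn₁, o.xn₂, o.yn₁,
      o.yn₂, o.n₁n₂, o21, oyx, lu, lv] at uu1 uu2 uv1 uv2 vv1 vv2 vu1 vu2 sxx syy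
    refine ⟨⟨cancel ?_, cancel ?_⟩, ⟨cancel ?_, cancel ?_⟩, ⟨cancel ?_, cancel ?_⟩,
      ⟨cancel ?_, cancel ?_⟩, cancel ?_, cancel ?_⟩
    · linear_combination lam p * xyu + sxx - lam p / 2 * xv
    · linear_combination syy + lam p / 2 * yu
    all_goals linarith
  have dux : ∀ p ∈ D, du x p = -dv φ p • y p + α p • n₁ p := fun p hp => by
    obtain ⟨⟨h1, -⟩, ⟨h2, h3⟩, -⟩ := hxy p hp
    have h0 : mink (du x p) (x p) = 0 := by have := kxx p hp (1, 0); unfold du; linarith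
    rw [(ho p hp).expand (du x p), h0, h1, h2, h3]
    module
  have dvx : ∀ p ∈ D, dv x p = -du φ p • y p + β p • n₂ p := fun p hp => by
    obtain ⟨⟨-, h1⟩, -, ⟨h2, h3⟩, -⟩ := hxy p hp
    have h0 : mink (dv x p) (x p) = 0 := by have := kxx p hp (0, 1); unfold dv; linarith
    rw [(ho p hp).expand (dv x p), h0, h1, h2, h3]
    module
  have duy : ∀ p ∈ D, du y p = -dv φ p • x p + β p • n₂ p := fun p hp => by
    obtain ⟨⟨h1, -⟩, -, -, ⟨h2, h3⟩, -⟩ := hxy p hp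
    have h0 : mink (du y p) (y p) = 0 := by have := kyy p hp (1, 0); unfold du; linarith
    have hx : mink (du y p) (x p) = dv φ p := by
      have := kxy p hp (1, 0); unfold du at h1 ⊢; linarith
    rw [(ho p hp).expand (du y p), h0, hx, h2, h3]
    module
  have dvy : ∀ p ∈ D, dv y p = -du φ p • x p + α p • n₁ p := fun p hp => by
    obtain ⟨⟨-, h1⟩, -, -, -, h2, h3⟩ := hxy p hp
    have h0 : mink (dv y p) (y p) = 0 := by have := kyy p hp (0, 1); unfold dv; linarith
    have hx : mink (dv y p) (x p) = du φ p := by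
      have := kxy p hp (0, 1); unfold dv at h1 ⊢; linarith
    rw [(ho p hp).expand (dv y p), h0, hx, h2, h3]
    module
  -- The normal connection comes from the Codazzi equations, the normal components of `x_uv = x_vu`.
  -- They give `⟨n₁_u, n₂⟩` and `⟨n₁_v, n₂⟩` multiplied by `β` and `α`, so both factors have to be
  -- nonzero.
  have hcod : ∀ p ∈ D, mink (du n₁ p) (n₂ p) = dv θ p ∧ mink (dv n₁ p) (n₂ p) = du θ p := by
    intro p hp
    have o := ho p hp
    have deriv2 : ∀ (f : ℝ × ℝ → R41) (a b : ℝ × ℝ → ℝ) (v w : ℝ × ℝ → R41),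
        ContDiffOn ℝ ∞ a D → ContDiffOn ℝ ∞ b D → ContDiffOn ℝ ∞ v D → ContDiffOn ℝ ∞ w D →
        (∀ q ∈ D, f q = -a q • v q + b q • w q) → ∀ h, fderiv ℝ f p h =
          -a p • fderiv ℝ v p h - fderiv ℝ a p h • v p
            + (b p • fderiv ℝ w p h + fderiv ℝ b p h • w p) := by
      intro f a b v w ha hb hv hw hf h
      have he : f =ᶠ[𝓝 p] fun q => -a q • v q + b q • w q :=
        Filter.eventually_of_mem (hD.mem_nhds hp) hf
      have hd := (((differentiableAt_of_smooth hD ha hp).hasFDerivAt.neg).smul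
        (differentiableAt_of_smooth hD hv hp).hasFDerivAt).add
        ((differentiableAt_of_smooth hD hb hp).hasFDerivAt.smul
        (differentiableAt_of_smooth hD hw hp).hasFDerivAt)
      rw [(hd.congr_of_eventuallyEq he).fderiv]
      simp
      module
    have e1 := deriv2 (du x) (dv φ) α y n₁ (contDiffOn_dv hD H.smooth_φ) H.smooth_α sy s1 dux (0, 1)
    have e2 := deriv2 (dv x) (du φ) β y n₂ (contDiffOn_du hD H.smooth_φ) H.smooth_β sy s2 dvx (1, 0)
    have e3 : fderiv ℝ (du x) p (0, 1) = fderiv ℝ (dv x) p (1, 0) := dv_du_eq_du_dv hD sx hp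
    rw [e1, e2, H.fderiv_α p hp, H.fderiv_β p hp] at e3
    change -dv φ p • dv y p - dv (dv φ) p • y p
      + (α p • dv n₁ p + (α p * dv φ p - β p * dv θ p) • n₁ p) =
      -du φ p • du y p - du (du φ) p • y p
      + (β p • du n₂ p + (β p * du φ p + α p * du θ p) • n₂ p) at e3
    have f1 := congrArg (mink · (n₁ p)) e3
    have f2 := congrArg (mink · (n₂ p)) e3
    obtain ⟨-, -, -, ⟨yu1, yu2⟩, yv1, yv2⟩ := hxy p hp
    have o21 : mink (n₂ p) (n₁ p) = 0 := by rw [mink_comm, o.n₁n₂]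
    simp only [mink_add_left, mink_sub_left, mink_smul_left, o.n₁n₁, o.n₂n₂, o.yn₁, o.yn₂, o.n₁n₂,
      o21, yu1, yu2, yv1, yv2] at f1 f2
    have g1 := k11 p hp (0, 1)
    have g2 := k22 p hp (1, 0)
    have g3 := k12 p hp (1, 0)
    change mink (dv n₁ p) (n₁ p) + mink (dv n₁ p) (n₁ p) = 0 at g1
    change mink (du n₂ p) (n₂ p) + mink (du n₂ p) (n₂ p) = 0 at g2
    change mink (du n₁ p) (n₂ p) + mink (du n₂ p) (n₁ p) = 0 at g3
    constructor
    · refine mul_left_cancel₀ (H.β_ne p hp) ?_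
      linear_combination β p * g3 + f1 - α p / 2 * g1
    · refine mul_left_cancel₀ (H.α_ne p hp) ?_
      linear_combination f2 + β p / 2 * g2
  refine ⟨sx, sy, s1, s2, hz, dux, dvx, duy, dvy, fun p hp => ?_, fun p hp => ?_, fun p hp => ?_,
    fun p hp => ?_, hu, hv⟩
  · have e1 : mink (du n₁ p) (n₁ p) = 0 := by have := k11 p hp (1, 0); unfold du; linarith
    have ex : mink (du n₁ p) (x p) = -α p := by
      have := kx1 p hp (1, 0); have := (hxy p hp).2.1.1; unfold du at *; linarith
    have ey : mink (du n₁ p) (y p) = 0 := by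
      have := ky1 p hp (1, 0); have := (hxy p hp).2.2.2.1.1; unfold du at *; linarith
    rw [(ho p hp).expand (du n₁ p), e1, ex, ey, (hcod p hp).1]
    module
  · have e1 : mink (dv n₁ p) (n₁ p) = 0 := by have := k11 p hp (0, 1); unfold dv; linarith
    have ex : mink (dv n₁ p) (x p) = 0 := by
      have := kx1 p hp (0, 1); have := (hxy p hp).2.2.1.1; unfold dv at *; linarith
    have ey : mink (dv n₁ p) (y p) = -α p := by
      have := ky1 p hp (0, 1); have := (hxy p hp).2.2.2.2.1; unfold dv at *; linarith
    rw [(ho p hp).expand (dv n₁ p), e1, ex, ey, (hcod p hp).2]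
    module
  · have e2 : mink (du n₂ p) (n₂ p) = 0 := by have := k22 p hp (1, 0); unfold du; linarith
    have ex : mink (du n₂ p) (x p) = 0 := by
      have := kx2 p hp (1, 0); have := (hxy p hp).2.1.2; unfold du at *; linarith
    have ey : mink (du n₂ p) (y p) = -β p := by
      have := ky2 p hp (1, 0); have := (hxy p hp).2.2.2.1.2; unfold du at *; linarith
    have e1 : mink (du n₂ p) (n₁ p) = -dv θ p := by
      have := k12 p hp (1, 0); have := (hcod p hp).1; unfold du at *; linarith
    rw [(ho p hp).expand (du n₂ p), e1, ex, ey, e2]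
    module
  · have e2 : mink (dv n₂ p) (n₂ p) = 0 := by have := k22 p hp (0, 1); unfold dv; linarith
    have ex : mink (dv n₂ p) (x p) = -β p := by
      have := kx2 p hp (0, 1); have := (hxy p hp).2.2.1.2; unfold dv at *; linarith
    have ey : mink (dv n₂ p) (y p) = 0 := by
      have := ky2 p hp (0, 1); have := (hxy p hp).2.2.2.2.2; unfold dv at *; linarith
    have e1 : mink (dv n₂ p) (n₁ p) = -du θ p := by
      have := k12 p hp (0, 1); have := (hcod p hp).2; unfold dv at *; linarith
    rw [(ho p hp).expand (dv n₂ p), e1, ex, ey, e2]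
    module

end

end TimelikeSurface

end MovingFrames

/-! ### The existence and uniqueness theorem. -/

theorem mainTheorem1
    (D : Set (ℝ × ℝ)) (hD : TimelikeSurface.IsDomain2 D)
    (μ ν : ℝ × ℝ → ℝ) (hμ : ContDiffOn ℝ ∞ μ D) (hν : ContDiffOn ℝ ∞ ν D)
    (hμν : ∀ p ∈ D, μ p * ν p ≠ 0) (hne : ∀ p ∈ D, μ p ^ 2 - ν p ^ 2 ≠ 0)
    (h₁ : ∀ p ∈ D, (μ p ^ 2 + ν p ^ 2) ^ (1 / 2 : ℝ) *
      TimelikeSurface.hypLaplace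
        (fun q => Real.log ((μ q ^ 2 + ν q ^ 2) ^ (1 / 4 : ℝ))) p = ν p ^ 2 - μ p ^ 2)
    (h₂ : ∀ p ∈ D, (μ p ^ 2 + ν p ^ 2) ^ (1 / 2 : ℝ) *
      TimelikeSurface.hypLaplace (fun q => Real.arctan (μ q / ν q)) p = 2 * ν p * μ p)
    (q₀ : ℝ × ℝ) (hq₀ : q₀ ∈ D)
    (p₀ x₀ y₀ n₁₀ n₂₀ : TimelikeSurface.R41)
    (hframe : TimelikeSurface.IsOrthonormalFrame x₀ y₀ n₁₀ n₂₀) :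
    ∃ D₀ : Set (ℝ × ℝ), TimelikeSurface.IsDomain2 D₀ ∧ D₀ ⊆ D ∧ q₀ ∈ D₀ ∧
      ∃ z : ℝ × ℝ → TimelikeSurface.R41,
        TimelikeSurface.IsSurfaceWithData μ ν D₀ q₀ p₀ x₀ y₀ n₁₀ n₂₀ z ∧
        ∀ D₁ : Set (ℝ × ℝ), TimelikeSurface.IsDomain2 D₁ → D₁ ⊆ D₀ → q₀ ∈ D₁ →
          ∀ z₁ : ℝ × ℝ → TimelikeSurface.R41,
            TimelikeSurface.IsSurfaceWithData μ ν D₁ q₀ p₀ x₀ y₀ n₁₀ n₂₀ z₁ →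
            Set.EqOn z₁ z D₁ := by
  have H := TimelikeSurface.isMotionData hD.1 hμ hν hμν h₁ h₂
  have hlam : ∀ p ∈ D, TimelikeSurface.scale μ ν p ^ 2 = 1 / √(μ p ^ 2 + ν p ^ 2) :=
    fun p hp => TimelikeSurface.scale_sq (hμν p hp)
  obtain ⟨r, hr, hsub, x, y, n₁, n₂, z, F, rfl, rfl, rfl, rfl, rfl⟩ :=
    TimelikeSurface.exists_isMovingFrame hD.1 H hq₀ x₀ y₀ n₁₀ n₂₀ p₀
  have hmem : q₀ ∈ Metric.ball q₀ r := Metric.mem_ball_self hr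
  have hconv : IsConnected (Metric.ball q₀ r) := (convex_ball q₀ r).isConnected ⟨q₀, hmem⟩
  have H' := H.mono hsub
  refine ⟨Metric.ball q₀ r, ⟨Metric.isOpen_ball, hconv⟩, hsub, hmem, z,
    F.isSurfaceWithData Metric.isOpen_ball H'
      (F.isOrthonormalFrame Metric.isOpen_ball hconv.isPreconnected H' hmem hframe)
      (fun _ _ => rfl) (fun _ _ => rfl) (fun p hp => hlam p (hsub hp)) q₀, ?_⟩
  intro D₁ hD₁ hsub₁ hq₁ z₁ S
  obtain ⟨x', y', n₁', n₂', G, ⟨hx, hy, hn₁, hn₂⟩, C⟩ := S.geometric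
  have H₁ := H'.mono hsub₁
  -- The frame of the competing surface solves the same linear system on the connected set `D₁` with
  -- the same value at `q₀`.
  have F₁ := TimelikeSurface.isMovingFrame_of_isGeometricFrameField hD₁.1 H₁ (fun _ _ => rfl)
    (fun _ _ => rfl) (fun p hp => hlam p (hsub (hsub₁ hp))) S.timelike.1 G C
  exact F₁.eqOn hD₁.1 hD₁.2.isPreconnected H₁ (F.mono hsub₁) hq₁ hx hy hn₁ hn₂ S.passes
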